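/- Let $F,A\in\mathbb R^{m\times n}$, $H\in\mathbb R^{p\times n}$, $\ell\in\mathbb R^m$, and let $Q_0,Q\in\mathbb R^{m\times m}$, $R\in\mathbb R^{p\times p}$ be symmetric positive definite. No regularity of the pencil $sF-A$ is assumed. For $\tau>0$ put $$\rho(g_0,g,h,\tau,S_0,S_1,S_2)=g_0^\top S_0g_0+\int_0^\tau\bigl(g^\top S_1g+h^\top S_2h\bigr)\,dt .$$ Observers. An admissible solution on $[0,\tau]$ is a tuple $(x,f,y,\eta)$ of square integrable functions on $[0,\tau]$ such that $Fx$ is absolutely continuous, $Fx(t)=Fx(0)+\int_0^t(Ax+f)\,ds$ for all $t\in[0,\tau]$, $y=Hx+\eta$ almost everywhere, and $\rho(Fx(0),f,\eta,t,Q_0,Q,R)\le1$ for all $t\in[0,\tau]$. Let $\mathscr F$ be the set of all maps $U$ from $\{(\tau,s):\tau>0,\ 0\le s\le\tau\}$ to $\mathbb R^p$ with $U(\tau,\cdot)\in L^2([0,\tau],\mathbb R^p)$ for every $\tau>0$. For $U\in\mathscr F$ let $$\sigma(U)=\limsup_{\tau\to\infty}\ \sup\Bigl(\ell^\top Fx(\tau)-\int_0^\tau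 y^\top(s)U(\tau,s)\,ds\Bigr)^2\in[0,+\infty],$$ where the supremum is over all admissible solutions $(x,f,y,\eta)$ on $[0,\tau]$. An infinite-horizon minimax observer is a $\widecheck U\in\mathscr F$ with $\sigma(\widecheck U)=\inf_{U\in\mathscr F}\sigma(U)<+\infty$. Dual problem. For $I=[0,\tau]$ or $I=[0,\infty)$ let $\mathscr D_\ell(I)$ be the set of pairs $(q,u)\in L^2_{loc}(I,\mathbb R^m)\times L^2_{loc}(I,\mathbb R^p)$ such that $F^\top q$ is absolutely continuous on compact subintervals of $I$, $F^\top q(t)=F^\top q(0)+\int_0^t(A^\top q-H^\top u)\,ds$ for all $t\in I$, and $F^\top q(0)=F^\top\ell$. The tuple $(F,A,H)$ is $\ell$-detectable if some $(q,u)\in\mathscr D_\ell([0,\infty))$ satisfies $F^\top q(t)\to0$ as $t\to\infty$. With $M^+$ the Moore-Penrose inverse of $M$, put $P=\mathcal I_m-(F^\top)^+F^\top$, $\mathcal M_{opt}=P(PQ_0^{-1}P)^+PQ_0^{-1}(F^\top)^+$, $\bar Q_0=F\bigl((F^\top)^+-\mathcal M_{opt}\bigr)^\top Q_0^{-1}\bigl((F^\top)^+-\mathcal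 M_{opt}\bigr)F^\top$, and $$J(q,u,\tau)=\rho(q(\tau),q,u,\tau,\bar Q_0,Q^{-1},R^{-1}),\qquad J^*_\infty=\limsup_{\tau\to\infty}\ \inf_{(q,u)\in\mathscr D_\ell([0,\tau])}J(q,u,\tau),$$ where $\inf\varnothing=+\infty$. Theorem. The following statements are equivalent: (i) $(F,A,H)$ is $\ell$-detectable; (ii) there exists an infinite-horizon minimax observer; (iii) there exist an infinite-horizon minimax observer $\widecheck U$ and a pair $(q^*,u^*)\in\mathscr D_\ell([0,\infty))$ such that $\widecheck U(t,s)=u^*(t-s)$ for all $t>0$ and $0\le s\le t$, and $$\sigma(\widecheck U)=J^*_\infty=\limsup_{\tau\to\infty}J(q^*,u^*,\tau)<+\infty .$$ -/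

import Mathlib

open Filter Topology MeasureTheory Matrix

namespace MinimaxDAE

/-! ### Moore-Penrose inverse of a real matrix -/

/-- `X` satisfies the four Penrose equations with respect to the real matrix `M`. -/
structure IsMoorePenrose {a b : ℕ} (M : Matrix (Fin a) (Fin b) ℝ)
    (X : Matrix (Fin b) (Fin a) ℝ) : Prop where
  mul_mul_self : M * X * M = M
  self_mul_mul : X * M * X = X
  left_symm : (M * X)ᵀ = M * X
  right_symm : (X * M)ᵀ = X * M

theorem IsMoorePenrose.unique {a b : ℕ} {M : Matrix (Fin a) (Fin b) ℝ}
    {X Y : Matrix (Fin b) (Fin a) ℝ} (hX : IsMoorePenrose M X) (hY : IsMoorePenrose M Y) :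
    X = Y := by
  have h1 : X * M = Y * M := by
    calc X * M = (X * M)ᵀ := hX.right_symm.symm
      _ = (X * (M * Y * M))ᵀ := by rw [hY.mul_mul_self]
      _ = ((X * M) * (Y * M))ᵀ := by simp only [Matrix.mul_assoc]
      _ = (Y * M) * (X * M) := by rw [transpose_mul, hX.right_symm, hY.right_symm]
      _ = Y * (M * X * M) := by simp only [Matrix.mul_assoc]
      _ = Y * M := by rw [hX.mul_mul_self]
  have h2 : M * X = M * Y := by
    calc M * X = (M * X)ᵀ := hX.left_symm.symm
      _ = ((M * Y * M) * X)ᵀ := by rw [hY.mul_mul_self]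
      _ = ((M * Y) * (M * X))ᵀ := by simp only [Matrix.mul_assoc]
      _ = (M * X) * (M * Y) := by rw [transpose_mul, hX.left_symm, hY.left_symm]
      _ = (M * X * M) * Y := by simp only [Matrix.mul_assoc]
      _ = M * Y := by rw [hX.mul_mul_self]
  calc X = X * M * X := hX.self_mul_mul.symm
    _ = Y * (M * X) := by rw [h1, Matrix.mul_assoc]
    _ = Y * M * Y := by rw [h2, Matrix.mul_assoc]
    _ = Y := hY.self_mul_mul

theorem exists_isMoorePenrose {a b : ℕ} (M : Matrix (Fin a) (Fin b) ℝ) :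
    ∃ X, IsMoorePenrose M X := by
  have hS : (Mᵀ * M).IsHermitian := by
    simpa [conjTranspose_eq_transpose_of_trivial] using isHermitian_conjTranspose_mul_self M
  obtain ⟨V, d, hV, hV', hM⟩ : ∃ (V : Matrix (Fin b) (Fin b) ℝ) (d : Fin b → ℝ),
      Vᵀ * V = 1 ∧ V * Vᵀ = 1 ∧ Mᵀ * M = V * diagonal d * Vᵀ := by
    refine ⟨hS.eigenvectorUnitary, hS.eigenvalues, ?_, ?_, ?_⟩
    · simpa [star_eq_conjTranspose, conjTranspose_eq_transpose_of_trivial] using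
        Unitary.coe_star_mul_self hS.eigenvectorUnitary
    · simpa [star_eq_conjTranspose, conjTranspose_eq_transpose_of_trivial] using
        Unitary.coe_mul_star_self hS.eigenvectorUnitary
    · have h := hS.spectral_theorem
      rw [Unitary.conjStarAlgAut_apply] at h
      simpa [star_eq_conjTranspose, conjTranspose_eq_transpose_of_trivial, Function.comp_def]
        using h
  set G : Matrix (Fin b) (Fin b) ℝ := V * diagonal (fun i => (d i)⁻¹) * Vᵀ with hG
  have hGT : Gᵀ = G := by
    simp [hG, transpose_mul, Matrix.mul_assoc]
  have key : ∀ e f : Fin b → ℝ, (V * diagonal e * Vᵀ) * (V * diagonal f * Vᵀ)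
      = V * diagonal (fun i => e i * f i) * Vᵀ := by
    intro e f
    calc (V * diagonal e * Vᵀ) * (V * diagonal f * Vᵀ)
        = V * diagonal e * (Vᵀ * V) * diagonal f * Vᵀ := by simp only [Matrix.mul_assoc]
      _ = V * (diagonal e * diagonal f) * Vᵀ := by
          rw [hV, Matrix.mul_one]; simp only [Matrix.mul_assoc]
      _ = _ := by rw [diagonal_mul_diagonal]
  have hGS : G * (Mᵀ * M) = (Mᵀ * M) * G := by
    rw [hM, hG, key, key]; simp only [mul_comm]
  have hSGS : (Mᵀ * M) * G * (Mᵀ * M) = Mᵀ * M := by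
    rw [hM, hG, key, key]
    congr 3
    funext i
    by_cases h : d i = 0 <;> simp [h]
  have hGSG : G * (Mᵀ * M) * G = G := by
    rw [hM, hG, key, key]
    congr 3
    funext i
    by_cases h : d i = 0 <;> simp [h]
  have hA : M * (G * Mᵀ) * M = M := by
    have h0 : (M * (G * Mᵀ) * M - M)ᵀ * (M * (G * Mᵀ) * M - M) = 0 := by
      have e1 : M * (G * Mᵀ) * M - M = M * (G * (Mᵀ * M) - 1) := by
        simp only [Matrix.mul_sub, Matrix.mul_one, Matrix.mul_assoc]
      have e2 : Mᵀ * (M * (G * (Mᵀ * M) - 1)) = 0 := by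
        have : Mᵀ * (M * (G * (Mᵀ * M) - 1)) = (Mᵀ * M) * G * (Mᵀ * M) - Mᵀ * M := by
          simp only [Matrix.mul_sub, Matrix.mul_one, Matrix.mul_assoc]
        rw [this, hSGS, sub_self]
      rw [e1, transpose_mul, Matrix.mul_assoc, e2, Matrix.mul_zero]
    have h1 : (M * (G * Mᵀ) * M - M) = 0 := by
      rw [← conjTranspose_eq_transpose_of_trivial] at h0
      exact conjTranspose_mul_self_eq_zero.mp h0
    exact sub_eq_zero.mp h1
  refine ⟨G * Mᵀ, hA, ?_, ?_, ?_⟩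
  · calc G * Mᵀ * M * (G * Mᵀ) = (G * (Mᵀ * M) * G) * Mᵀ := by simp only [Matrix.mul_assoc]
      _ = G * Mᵀ := by rw [hGSG]
  · rw [transpose_mul, transpose_mul, transpose_transpose, hGT, Matrix.mul_assoc]
  · calc (G * Mᵀ * M)ᵀ = (Mᵀ * M) * G := by
          simp only [transpose_mul, transpose_transpose, hGT, Matrix.mul_assoc]
      _ = G * Mᵀ * M := hGS.symm.trans (Matrix.mul_assoc _ _ _).symm

/-- The Moore-Penrose inverse `M⁺`, the unique solution of the Penrose equations. -/
noncomputable def pinv {a b : ℕ} (M : Matrix (Fin a) (Fin b) ℝ) : Matrix (Fin b) (Fin a) ℝ :=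
  (exists_isMoorePenrose M).choose

theorem pinv_spec {a b : ℕ} (M : Matrix (Fin a) (Fin b) ℝ) : IsMoorePenrose M (pinv M) :=
  (exists_isMoorePenrose M).choose_spec

/-! ### Function classes on a time interval

Functions on a time interval `I ⊆ ℝ` are represented by functions on `ℝ` of which only the values
on `I` matter. -/

/-- `g ∈ L²_loc(I, ℝᵏ)`: `g` is square integrable on every compact interval contained in `I`. -/
def L2Loc {k : ℕ} (I : Set ℝ) (g : ℝ → Fin k → ℝ) : Prop :=
  ∀ a b : ℝ, Set.Icc a b ⊆ I → MemLp g 2 (volume.restrict (Set.Icc a b))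

/-- `g` is absolutely continuous on every compact interval contained in `I`. -/
def ACLoc {k : ℕ} (I : Set ℝ) (g : ℝ → Fin k → ℝ) : Prop :=
  ∀ a b : ℝ, a ≤ b → Set.Icc a b ⊆ I → AbsolutelyContinuousOnInterval g a b

/-- `ρ(g₀, g, h, τ, S₀, S₁, S₂) = g₀ᵀ S₀ g₀ + ∫₀^τ (gᵀ S₁ g + hᵀ S₂ h) dt`. -/
noncomputable def rho {m p : ℕ} (g₀ : Fin m → ℝ) (g : ℝ → Fin m → ℝ) (h : ℝ → Fin p → ℝ) (τ : ℝ)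
    (S₀ S₁ : Matrix (Fin m) (Fin m) ℝ) (S₂ : Matrix (Fin p) (Fin p) ℝ) : ℝ :=
  g₀ ⬝ᵥ (S₀ *ᵥ g₀) + ∫ t in (0 : ℝ)..τ, (g t ⬝ᵥ (S₁ *ᵥ g t) + h t ⬝ᵥ (S₂ *ᵥ h t))

/-! ### The DAE and its observers -/

/-- `(x, f, y, η)` is a solution on `I` of `d(Fx)/dt = A x + f`, `y = H x + η`. -/
structure IsSolution {m n p : ℕ} (F A : Matrix (Fin m) (Fin n) ℝ) (H : Matrix (Fin p) (Fin n) ℝ)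
    (I : Set ℝ) (x : ℝ → Fin n → ℝ) (f : ℝ → Fin m → ℝ) (y η : ℝ → Fin p → ℝ) : Prop where
  memLp_x : L2Loc I x
  memLp_f : L2Loc I f
  memLp_y : L2Loc I y
  memLp_η : L2Loc I η
  absCont : ACLoc I (fun t => F *ᵥ x t)
  state_eq : ∀ t ∈ I, F *ᵥ x t = F *ᵥ x 0 + ∫ s in (0 : ℝ)..t, (A *ᵥ x s + f s)
  output_eq : ∀ᵐ t ∂(volume.restrict I), y t = H *ᵥ x t + η t

/-- `(x, f, y, η)` is an admissible solution on `I`: a solution for which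
`ρ(Fx(0), f, η, t, Q₀, Q, R) ≤ 1` for all `t ∈ I`. -/
structure IsAdmissible {m n p : ℕ} (F A : Matrix (Fin m) (Fin n) ℝ) (H : Matrix (Fin p) (Fin n) ℝ)
    (Q₀ Q : Matrix (Fin m) (Fin m) ℝ) (R : Matrix (Fin p) (Fin p) ℝ)
    (I : Set ℝ) (x : ℝ → Fin n → ℝ) (f : ℝ → Fin m → ℝ) (y η : ℝ → Fin p → ℝ) : Prop where
  solution : IsSolution F A H I x f y η
  bound : ∀ t ∈ I, rho (F *ᵥ x 0) f η t Q₀ Q R ≤ 1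

/-- The linear estimate `∫₀ᵗ yᵀ(s) U(s) ds` generated by `U`. -/
noncomputable def estimate {p : ℕ} (U y : ℝ → Fin p → ℝ) (t : ℝ) : ℝ :=
  ∫ s in (0 : ℝ)..t, y s ⬝ᵥ U s

/-- The worst-case error `σ(U, ℓ, t)` on `[0, t]`: the supremum of the squared estimation error
`(ℓᵀ F x(t) - ∫₀ᵗ yᵀ U)²` over all admissible solutions on `[0, t]`. -/
noncomputable def worstCaseError {m n p : ℕ} (F A : Matrix (Fin m) (Fin n) ℝ)
    (H : Matrix (Fin p) (Fin n) ℝ) (Q₀ Q : Matrix (Fin m) (Fin m) ℝ)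
    (R : Matrix (Fin p) (Fin p) ℝ) (ℓ : Fin m → ℝ) (U : ℝ → Fin p → ℝ) (t : ℝ) : EReal :=
  ⨆ (x : ℝ → Fin n → ℝ) (f : ℝ → Fin m → ℝ) (y : ℝ → Fin p → ℝ) (η : ℝ → Fin p → ℝ)
    (_ : IsAdmissible F A H Q₀ Q R (Set.Icc 0 t) x f y η),
    (((ℓ ⬝ᵥ (F *ᵥ x t) - estimate U y t) ^ 2 : ℝ) : EReal)

/-- The class `𝓕` of observers: maps `(τ, s) ↦ U(τ, s)`, `τ > 0`, `s ∈ [0, τ]`, with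
`U(τ, ·) ∈ L²([0, τ], ℝᵖ)` for all `τ > 0`. -/
def observerClass (p : ℕ) : Set (ℝ → ℝ → Fin p → ℝ) :=
  {U | ∀ τ : ℝ, 0 < τ → MemLp (U τ) 2 (volume.restrict (Set.Icc 0 τ))}

/-- The infinite-horizon worst-case error `σ(U, ℓ) = limsup_{t → ∞} σ(U(t, ·), ℓ, t)`. -/
noncomputable def asymptoticError {m n p : ℕ} (F A : Matrix (Fin m) (Fin n) ℝ)
    (H : Matrix (Fin p) (Fin n) ℝ) (Q₀ Q : Matrix (Fin m) (Fin m) ℝ)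
    (R : Matrix (Fin p) (Fin p) ℝ) (ℓ : Fin m → ℝ) (U : ℝ → ℝ → Fin p → ℝ) : EReal :=
  limsup (fun t : ℝ => worstCaseError F A H Q₀ Q R ℓ (U t) t) atTop

/-- `U` is an infinite-horizon minimax observer: `U ∈ 𝓕` and
`σ(U, ℓ) = inf_{V ∈ 𝓕} σ(V, ℓ) < +∞`. -/
structure IsMinimaxObserver {m n p : ℕ} (F A : Matrix (Fin m) (Fin n) ℝ)
    (H : Matrix (Fin p) (Fin n) ℝ) (Q₀ Q : Matrix (Fin m) (Fin m) ℝ)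
    (R : Matrix (Fin p) (Fin p) ℝ) (ℓ : Fin m → ℝ) (U : ℝ → ℝ → Fin p → ℝ) : Prop where
  mem : U ∈ observerClass p
  eq_iInf : asymptoticError F A H Q₀ Q R ℓ U
    = ⨅ V ∈ observerClass p, asymptoticError F A H Q₀ Q R ℓ V
  lt_top : asymptoticError F A H Q₀ Q R ℓ U < ⊤

/-! ### The dual control problem -/

/-- `(q, u) ∈ 𝓓_ℓ(I)`: `(q, u)` is a solution on `I` of the dual DAE
`d(Fᵀq)/dt = Aᵀ q - Hᵀ u` with `Fᵀ q(0) = Fᵀ ℓ`. -/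
structure IsDualSolution {m n p : ℕ} (F A : Matrix (Fin m) (Fin n) ℝ)
    (H : Matrix (Fin p) (Fin n) ℝ) (ℓ : Fin m → ℝ)
    (I : Set ℝ) (q : ℝ → Fin m → ℝ) (u : ℝ → Fin p → ℝ) : Prop where
  memLp_q : L2Loc I q
  memLp_u : L2Loc I u
  absCont : ACLoc I (fun t => Fᵀ *ᵥ q t)
  state_eq : ∀ t ∈ I, Fᵀ *ᵥ q t = Fᵀ *ᵥ q 0 + ∫ s in (0 : ℝ)..t, (Aᵀ *ᵥ q s - Hᵀ *ᵥ u s)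
  initial : Fᵀ *ᵥ q 0 = Fᵀ *ᵥ ℓ

/-- `(F, A, H)` is `ℓ`-detectable: some `(q, u) ∈ 𝓓_ℓ([0, ∞))` has `Fᵀ q(t) → 0`. -/
def IsDetectable {m n p : ℕ} (F A : Matrix (Fin m) (Fin n) ℝ)
    (H : Matrix (Fin p) (Fin n) ℝ) (ℓ : Fin m → ℝ) : Prop :=
  ∃ (q : ℝ → Fin m → ℝ) (u : ℝ → Fin p → ℝ), IsDualSolution F A H ℓ (Set.Ici 0) q u ∧
    Tendsto (fun t => Fᵀ *ᵥ q t) atTop (𝓝 0)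

/-- `P = I - (Fᵀ)⁺ Fᵀ`, the orthogonal projection onto `ker Fᵀ`. -/
noncomputable def kerProj {m n : ℕ} (F : Matrix (Fin m) (Fin n) ℝ) : Matrix (Fin m) (Fin m) ℝ :=
  1 - pinv Fᵀ * Fᵀ

/-- `M_opt = P (P Q₀⁻¹ P)⁺ P Q₀⁻¹ (Fᵀ)⁺`. -/
noncomputable def Mopt {m n : ℕ} (F : Matrix (Fin m) (Fin n) ℝ) (Q₀ : Matrix (Fin m) (Fin m) ℝ) :
    Matrix (Fin m) (Fin n) ℝ :=
  kerProj F * pinv (kerProj F * Q₀⁻¹ * kerProj F) * kerProj F * Q₀⁻¹ * pinv Fᵀ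

/-- `Q̄₀ = F ((Fᵀ)⁺ - M_opt)ᵀ Q₀⁻¹ ((Fᵀ)⁺ - M_opt) Fᵀ`. -/
noncomputable def Qbar {m n : ℕ} (F : Matrix (Fin m) (Fin n) ℝ) (Q₀ : Matrix (Fin m) (Fin m) ℝ) :
    Matrix (Fin m) (Fin m) ℝ :=
  F * (pinv Fᵀ - Mopt F Q₀)ᵀ * Q₀⁻¹ * (pinv Fᵀ - Mopt F Q₀) * Fᵀ

/-- The dual cost `J(q, u, t) = ρ(q(t), q, u, t, Q̄₀, Q⁻¹, R⁻¹)`. -/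
noncomputable def dualCost {m n p : ℕ} (F : Matrix (Fin m) (Fin n) ℝ)
    (Q₀ Q : Matrix (Fin m) (Fin m) ℝ) (R : Matrix (Fin p) (Fin p) ℝ)
    (q : ℝ → Fin m → ℝ) (u : ℝ → Fin p → ℝ) (t : ℝ) : ℝ :=
  rho (q t) q u t (Qbar F Q₀) Q⁻¹ R⁻¹

/-- The optimal value `inf_{(q, u) ∈ 𝓓_ℓ([0, τ])} J(q, u, τ)` of the dual problem on `[0, τ]`;
it is `+∞` if `𝓓_ℓ([0, τ])` is empty. -/
noncomputable def dualValue {m n p : ℕ} (F A : Matrix (Fin m) (Fin n) ℝ)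
    (H : Matrix (Fin p) (Fin n) ℝ) (Q₀ Q : Matrix (Fin m) (Fin m) ℝ)
    (R : Matrix (Fin p) (Fin p) ℝ) (ℓ : Fin m → ℝ) (τ : ℝ) : EReal :=
  ⨅ (q : ℝ → Fin m → ℝ) (u : ℝ → Fin p → ℝ) (_ : IsDualSolution F A H ℓ (Set.Icc 0 τ) q u),
    ((dualCost F Q₀ Q R q u τ : ℝ) : EReal)

/-- `(q, u)` solves the infinite-horizon dual control problem: `(q, u) ∈ 𝓓_ℓ([0, ∞))` and
`limsup_{τ → ∞} J(q, u, τ) = limsup_{τ → ∞} inf_{𝓓_ℓ([0, τ])} J(·, ·, τ) < +∞`. -/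
structure IsDualOptimal {m n p : ℕ} (F A : Matrix (Fin m) (Fin n) ℝ)
    (H : Matrix (Fin p) (Fin n) ℝ) (Q₀ Q : Matrix (Fin m) (Fin m) ℝ)
    (R : Matrix (Fin p) (Fin p) ℝ) (ℓ : Fin m → ℝ)
    (q : ℝ → Fin m → ℝ) (u : ℝ → Fin p → ℝ) : Prop where
  solution : IsDualSolution F A H ℓ (Set.Ici 0) q u
  limsup_eq : limsup (fun τ : ℝ => ((dualCost F Q₀ Q R q u τ : ℝ) : EReal)) atTop
    = limsup (fun τ : ℝ => dualValue F A H Q₀ Q R ℓ τ) atTop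
  lt_top : limsup (fun τ : ℝ => dualValue F A H Q₀ Q R ℓ τ) atTop < ⊤

end MinimaxDAE

open MinimaxDAE

/-! The proof combines a duality between estimating `ℓᵀFx(τ)` and steering the dual DAE in reversed
time with a Hilbert space limit as the horizon grows.

Fixed horizon. Integration by parts turns the error of the observer `s ↦ u(τ - s)` generated by a
dual solution `(q, u)` into an inner product of the reversed pair `(q, -u)` and the terminal state
with the disturbances `(Fx(0), f, η)`. Cauchy-Schwarz then bounds the squared error by `J(q, u, τ)`
(`worstCaseError_le_dualCost`). Conversely, on solutions with `y = 0` every observer returns the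
estimate zero. So a worst-case error at most `c` bounds the functional `ℓᵀFx(τ)` by the size of the
disturbances, and its Riesz representative, reversed in time, is a dual solution with `J ≤ c`
(`exists_dualCost_le`). The two bounds match because `Q̄₀` is the form `bᵀQ₀⁻¹b` minimized over `Fᵀb
= Fᵀq`. Hence the dual value bounds the error of every observer from below, and no minimizer on a
finite horizon is needed.

Infinite horizon. In weighted coordinates the running cost is a squared L² norm and dual solutions
are trajectories of `d(Ew)/dt = Gw` with `E` possibly singular. The pivot is that the running cost
can be kept bounded on all `[0, N]`. A finite limsup of the dual values gives this by restriction.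
Detectability gives it because the initial states of decaying trajectories form a finite-dimensional
subspace to which these trajectories keep returning. A linear choice of trajectories halves the
state in a fixed time at a cost quadratic in the state, and repetition costs a geometric series
(`exists_halving`, `exists_bounded_cost`).

Conversely, bounded running costs make near minimizers on `[0, N]` converge in L² of the half-line,
by the parallelogram law, to a trajectory whose cost is the supremum of the finite-horizon infima
(`exists_optimal_trajectory`). Its square integrability forces the state to zero
(`tendsto_trajState_of_memLp`). This is detectability, and it also removes the terminal cost in the
limit, so `J` along this trajectory converges to the lower bound and the trajectory is optimal. -/

namespace MinimaxDAE

/-! ### Two Hilbert space lemmas -/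

section Hilbert

variable {K : Type*} [NormedAddCommGroup K] [InnerProductSpace ℝ K] [CompleteSpace K]

/-- For a decreasing sequence of nonempty midpoint-convex sets whose distances to the origin are
bounded, suitable points of the sets converge, and the squared norm of the limit is the supremum of
the squared distances to the origin. -/
theorem exists_limit_of_antitone_midpoint (C : ℕ → Set K) (hC : Antitone C)
    (hmid : ∀ N, ∀ x ∈ C N, ∀ y ∈ C N, (1 / 2 : ℝ) • (x + y) ∈ C N)
    (c : ℝ) (hne : ∀ N, ∃ x ∈ C N, ‖x‖ ^ 2 ≤ c) :
    ∃ k : K, (∃ s : ℕ → K, (∀ N, s N ∈ C N) ∧ Tendsto s atTop (𝓝 k)) ∧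
      ∀ b < ‖k‖ ^ 2, ∃ N, ∀ x ∈ C N, b < ‖x‖ ^ 2 := by
  set e : ℕ → ℝ := fun N => sInf ((fun x : K => ‖x‖ ^ 2) '' C N) with he
  have hbdd : ∀ N, BddBelow ((fun x : K => ‖x‖ ^ 2) '' C N) := fun N =>
    ⟨0, by rintro _ ⟨x, -, rfl⟩; positivity⟩
  have hnonempty : ∀ N, ((fun x : K => ‖x‖ ^ 2) '' C N).Nonempty := fun N =>
    let ⟨x, hx, _⟩ := hne N; ⟨_, x, hx, rfl⟩
  have hle : ∀ N, ∀ x ∈ C N, e N ≤ ‖x‖ ^ 2 := fun N x hx => csInf_le (hbdd N) ⟨x, hx, rfl⟩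
  have hmono : Monotone e := fun N M h =>
    csInf_le_csInf (hbdd N) (hnonempty M) (Set.image_mono (hC h))
  have hupper : BddAbove (Set.range e) := ⟨c, by
    rintro _ ⟨N, rfl⟩
    obtain ⟨x, hx, hxc⟩ := hne N
    exact (hle N x hx).trans hxc⟩
  have hlim := tendsto_atTop_ciSup hmono hupper
  set L := ⨆ N, e N
  have heL : ∀ N, e N ≤ L := fun N => le_ciSup hupper N
  have hs : ∀ N : ℕ, ∃ x ∈ C N, ‖x‖ ^ 2 < e N + 1 / ((N : ℝ) + 1) := by
    intro N
    have hpos : (0 : ℝ) < 1 / ((N : ℝ) + 1) := by positivity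
    obtain ⟨_, ⟨x, hx, rfl⟩, hlt⟩ := exists_lt_of_csInf_lt (hnonempty N)
      (show sInf _ < e N + 1 / ((N : ℝ) + 1) from lt_add_of_pos_right _ hpos)
    exact ⟨x, hx, hlt⟩
  choose s hsC hslt using hs
  have hone : Tendsto (fun N : ℕ => 1 / ((N : ℝ) + 1)) atTop (𝓝 0) :=
    tendsto_one_div_add_atTop_nhds_zero_nat
  -- For `N ≤ M` the midpoint of `s N` and `s M` lies in `C N`, so its squared norm is at least `e
  -- N`. The parallelogram law then gives `‖s N - s M‖² ≤ 2 (e N + 1/(N+1)) + 2 (e M + 1/(M+1)) - 4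
  -- e N`, which is at most `b N`.
  set b : ℕ → ℝ := fun N => 2 * (L - e N) + 4 * (1 / ((N : ℝ) + 1)) with hb
  have hblim : Tendsto b atTop (𝓝 0) := by
    have := ((tendsto_const_nhds (x := L)).sub hlim |>.const_mul 2).add (hone.const_mul 4)
    simpa [hb] using this
  have hdist : ∀ N M, N ≤ M → ‖s N - s M‖ ^ 2 ≤ b N := by
    intro N M h
    have h1 := hle N _ (hmid N _ (hsC N) _ (hC h (hsC M)))
    rw [norm_smul, mul_pow] at h1
    norm_num at h1
    have h2 := parallelogram_law_with_norm ℝ (s N) (s M)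
    have h3 := hslt N
    have h4 := hslt M
    have h5 := heL M
    have h6 : 1 / ((M : ℝ) + 1) ≤ 1 / ((N : ℝ) + 1) := by
      have : (N : ℝ) ≤ M := by exact_mod_cast h
      gcongr
    simp only [hb]
    nlinarith
  have hcauchy : CauchySeq s := by
    refine cauchySeq_of_le_tendsto_0' (fun N => √(b N)) (fun N M h => ?_) ?_
    · rw [dist_eq_norm]
      exact Real.le_sqrt_of_sq_le (hdist N M h)
    · simpa [Function.comp_def] using (Real.continuous_sqrt.tendsto 0).comp hblim
  obtain ⟨k, hk⟩ := cauchySeq_tendsto_of_complete hcauchy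
  refine ⟨k, ⟨s, hsC, hk⟩, fun r hr => ?_⟩
  have hn1 : Tendsto (fun N => ‖s N‖ ^ 2) atTop (𝓝 (‖k‖ ^ 2)) := hk.norm.pow 2
  have hn2 : Tendsto (fun N => ‖s N‖ ^ 2) atTop (𝓝 L) :=
    tendsto_of_tendsto_of_tendsto_of_le_of_le hlim
      (by simpa using hlim.add hone) (fun N => hle N _ (hsC N)) (fun N => (hslt N).le)
  rw [tendsto_nhds_unique hn1 hn2] at hr
  obtain ⟨N, hN⟩ := (hlim.eventually_const_lt hr).exists
  exact ⟨N, fun x hx => hN.trans_le (hle N x hx)⟩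

/-- A linear functional `L` with `(L v)² ≤ c` whenever `‖T v‖ ≤ 1` is represented through `T` by a
vector `k` with `‖k‖² ≤ c`. -/
theorem exists_inner_representation {V : Type*} [AddCommGroup V] [Module ℝ V] (T : V →ₗ[ℝ] K)
    (L : V →ₗ[ℝ] ℝ) (c : ℝ) (h : ∀ v, ‖T v‖ ≤ 1 → (L v) ^ 2 ≤ c) :
    ∃ k : K, ‖k‖ ^ 2 ≤ c ∧ ∀ v, L v = inner ℝ k (T v) := by
  have hc : 0 ≤ c := by simpa using h 0 (by simp)
  have hker : LinearMap.ker T ≤ LinearMap.ker L := by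
    intro v hv
    rw [LinearMap.mem_ker] at hv ⊢
    by_contra hne
    -- The scaling gives `L` the value `√c + 1`, whose square exceeds `c`, while `T` still gives
    -- zero.
    have := h (((√c + 1) / L v) • v) (by simp [hv])
    rw [map_smul, smul_eq_mul, div_mul_cancel₀ _ hne] at this
    nlinarith [Real.sq_sqrt hc, Real.sqrt_nonneg c]
  have hbound : ∀ v, ‖L v‖ ≤ √c * ‖T v‖ := by
    intro v
    by_cases h0 : T v = 0
    · have : L v = 0 := hker (LinearMap.mem_ker.mpr h0)
      simp [this, h0]
    · have hpos : 0 < ‖T v‖ := norm_pos_iff.mpr h0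
      have := h (‖T v‖⁻¹ • v) (by rw [map_smul, norm_smul]; simp [hpos.ne'])
      rw [map_smul, smul_eq_mul] at this
      have h2 := Real.abs_le_sqrt this
      rw [abs_mul, abs_inv, abs_of_pos hpos, inv_mul_le_iff₀ hpos] at h2
      rw [Real.norm_eq_abs]; linarith
  -- `L` descends to the range of `T`, which need not be closed. Hahn-Banach extends it to `K`
  -- without increasing the norm, and Riesz supplies the vector.
  set L' : LinearMap.range T →ₗ[ℝ] ℝ :=
    (LinearMap.ker T).liftQ L hker ∘ₗ T.quotKerEquivRange.symm.toLinearMap with hL'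
  have hL'T : ∀ v, L' ⟨T v, v, rfl⟩ = L v := by
    intro v
    have : T.quotKerEquivRange.symm ⟨T v, v, rfl⟩ = (LinearMap.ker T).mkQ v :=
      T.quotKerEquivRange_symm_apply_image v _
    simp [hL', this]
  obtain ⟨g, hg, hgn⟩ := exists_extension_norm_eq (𝕜 := ℝ) (LinearMap.range T)
    (L'.mkContinuous (√c) (by rintro ⟨_, v, rfl⟩; rw [hL'T]; exact hbound v))
  refine ⟨(InnerProductSpace.toDual ℝ K).symm g, ?_, fun v => ?_⟩
  · have hn : ‖g‖ ≤ √c := hgn.trans_le (LinearMap.mkContinuous_norm_le _ (Real.sqrt_nonneg c) _)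
    rw [LinearIsometryEquiv.norm_map]
    exact (pow_le_pow_left₀ (norm_nonneg g) hn 2).trans_eq (Real.sq_sqrt hc)
  · rw [InnerProductSpace.toDual_symm_apply, ← hL'T v]
    exact (hg ⟨T v, v, rfl⟩).symm

end Hilbert

/-! ### Primitives of integrable functions -/

theorem absolutelyContinuousOnInterval_congr {X : Type*} [PseudoMetricSpace X] {f g : ℝ → X}
    {a b : ℝ} (hf : AbsolutelyContinuousOnInterval f a b) (h : Set.EqOn f g (Set.uIcc a b)) :
    AbsolutelyContinuousOnInterval g a b := by
  rw [absolutelyContinuousOnInterval_iff] at hf ⊢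
  intro ε hε
  obtain ⟨δ, hδ, H⟩ := hf ε hε
  refine ⟨δ, hδ, fun E hE hlt => ?_⟩
  refine lt_of_eq_of_lt (Finset.sum_congr rfl fun i hi => ?_) (H E hE hlt)
  have := hE.1 i hi
  rw [h this.1, h this.2]

theorem absolutelyContinuousOnInterval_const {X : Type*} [PseudoMetricSpace X] (x : X) (a b : ℝ) :
    AbsolutelyContinuousOnInterval (fun _ : ℝ => x) a b :=
  (LipschitzWith.const x).lipschitzOnWith.absolutelyContinuousOnInterval

theorem absolutelyContinuousOnInterval_pi {k : ℕ} {f : ℝ → Fin k → ℝ} {a b : ℝ}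
    (hf : ∀ i, AbsolutelyContinuousOnInterval (fun t => f t i) a b) :
    AbsolutelyContinuousOnInterval f a b := by
  refine squeeze_zero (fun E => Finset.sum_nonneg fun _ _ => dist_nonneg) (fun E => ?_)
    (by simpa using tendsto_finsetSum Finset.univ (fun i _ => hf i))
  rw [Finset.sum_comm]
  refine Finset.sum_le_sum fun j _ => (dist_pi_le_iff ?_).2 fun i => ?_
  · exact Finset.sum_nonneg fun _ _ => dist_nonneg
  · exact Finset.single_le_sum (f := fun i => dist (f (E.2 j).1 i) (f (E.2 j).2 i))
      (fun _ _ => dist_nonneg) (Finset.mem_univ i)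

theorem intervalIntegral_apply {k : ℕ} {f : ℝ → Fin k → ℝ} {a b : ℝ}
    (hf : IntervalIntegrable f volume a b) (i : Fin k) :
    (∫ t in a..b, f t) i = ∫ t in a..b, f t i :=
  ((ContinuousLinearMap.proj (R := ℝ) (φ := fun _ : Fin k => ℝ) i).intervalIntegral_comp_comm
    hf).symm

theorem intervalIntegrable_apply {k : ℕ} {f : ℝ → Fin k → ℝ} {a b : ℝ}
    (hf : IntervalIntegrable f volume a b) (i : Fin k) :
    IntervalIntegrable (fun t => f t i) volume a b :=
  ⟨(ContinuousLinearMap.proj (R := ℝ) (φ := fun _ : Fin k => ℝ) i).integrable_comp hf.1,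
    (ContinuousLinearMap.proj (R := ℝ) (φ := fun _ : Fin k => ℝ) i).integrable_comp hf.2⟩

theorem absolutelyContinuousOnInterval_primitive {k : ℕ} {f : ℝ → Fin k → ℝ} {a b c : ℝ}
    (x₀ : Fin k → ℝ) (hf : IntervalIntegrable f volume c a) (hf' : IntervalIntegrable f volume c b) :
    AbsolutelyContinuousOnInterval (fun t => x₀ + ∫ s in c..t, f s) a b := by
  have hab : IntervalIntegrable f volume a b := hf.symm.trans hf'
  refine absolutelyContinuousOnInterval_pi fun i => ?_
  have h1 := (intervalIntegrable_apply hab i).absolutelyContinuousOnInterval_intervalIntegral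
    (Set.left_mem_uIcc)
  have h2 := absolutelyContinuousOnInterval_const (x₀ i + ∫ s in c..a, f s i) a b
  refine absolutelyContinuousOnInterval_congr (h2.add h1) fun t ht => ?_
  have hat : IntervalIntegrable f volume a t := hab.mono_set (Set.uIcc_subset_uIcc_left ht)
  rw [Pi.add_apply, Pi.add_apply, intervalIntegral_apply (hf.trans hat), add_assoc,
    intervalIntegral.integral_add_adjacent_intervals (intervalIntegrable_apply hf i)
      (intervalIntegrable_apply hat i)]

/-- The product rule for absolutely continuous functions, with the almost everywhere derivatives
replaced by the given integrands. -/
theorem integral_mul_primitive {a b : ℝ → ℝ} {τ : ℝ} (α₀ β₀ : ℝ)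
    (ha : IntervalIntegrable a volume 0 τ) (hb : IntervalIntegrable b volume 0 τ) :
    ∫ t in (0 : ℝ)..τ, (a t * (β₀ + ∫ s in (0 : ℝ)..t, b s) + (α₀ + ∫ s in (0 : ℝ)..t, a s) * b t)
      = (α₀ + ∫ s in (0 : ℝ)..τ, a s) * (β₀ + ∫ s in (0 : ℝ)..τ, b s) - α₀ * β₀ := by
  have hac : ∀ (c : ℝ) {f : ℝ → ℝ}, IntervalIntegrable f volume 0 τ →
      AbsolutelyContinuousOnInterval (fun t => c + ∫ s in (0 : ℝ)..t, f s) 0 τ := fun c f hf =>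
    (absolutelyContinuousOnInterval_const c 0 τ).add
      (hf.absolutelyContinuousOnInterval_intervalIntegral Set.left_mem_uIcc)
  have h := (hac α₀ ha).integral_deriv_mul_eq_sub (hac β₀ hb)
  simp only [intervalIntegral.integral_same, add_zero] at h
  rw [← h]
  refine intervalIntegral.integral_congr_ae ?_
  filter_upwards [ha.ae_hasDerivAt_integral, hb.ae_hasDerivAt_integral] with t h1 h2 ht
  have ht' := Set.uIoc_subset_uIcc ht
  rw [((h1 ht' 0 Set.left_mem_uIcc).const_add α₀).deriv,
    ((h2 ht' 0 Set.left_mem_uIcc).const_add β₀).deriv]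

/-- Integration by parts for the dot product of two primitives. -/
theorem integral_dotProduct_primitive {k : ℕ} {a b α β : ℝ → Fin k → ℝ} {τ : ℝ} (hτ : 0 ≤ τ)
    (ha : IntervalIntegrable a volume 0 τ) (hb : IntervalIntegrable b volume 0 τ)
    (hα : ∀ t ∈ Set.Icc 0 τ, α t = α 0 + ∫ s in (0 : ℝ)..t, a s)
    (hβ : ∀ t ∈ Set.Icc 0 τ, β t = β 0 + ∫ s in (0 : ℝ)..t, b s) :
    ∫ t in (0 : ℝ)..τ, (a t ⬝ᵥ β t + α t ⬝ᵥ b t) = α τ ⬝ᵥ β τ - α 0 ⬝ᵥ β 0 := by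
  have hcoord : ∀ {f φ : ℝ → Fin k → ℝ}, IntervalIntegrable f volume 0 τ →
      (∀ t ∈ Set.Icc 0 τ, φ t = φ 0 + ∫ s in (0 : ℝ)..t, f s) →
      ∀ i, ∀ t ∈ Set.Icc 0 τ, φ t i = φ 0 i + ∫ s in (0 : ℝ)..t, f s i := by
    intro f φ hf hφ i t ht
    have : IntervalIntegrable f volume 0 t :=
      hf.mono_set (Set.uIcc_subset_uIcc_left (by rwa [Set.uIcc_of_le hτ]))
    rw [hφ t ht, Pi.add_apply, intervalIntegral_apply this]
  have hτ' : τ ∈ Set.Icc 0 τ := ⟨hτ, le_rfl⟩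
  have hInt : ∀ i, IntervalIntegrable (fun t => a t i * (β 0 i + ∫ s in (0 : ℝ)..t, b s i)
      + (α 0 i + ∫ s in (0 : ℝ)..t, a s i) * b t i) volume 0 τ := by
    intro i
    have hc : ∀ {f : ℝ → ℝ} (c : ℝ), IntervalIntegrable f volume 0 τ →
        ContinuousOn (fun t => c + ∫ s in (0 : ℝ)..t, f s) (Set.uIcc 0 τ) := fun c hf =>
      continuousOn_const.add
        (intervalIntegral.continuousOn_primitive_interval' hf Set.left_mem_uIcc)
    exact ((intervalIntegrable_apply ha i).mul_continuousOn
      (hc _ (intervalIntegrable_apply hb i))).add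
      ((intervalIntegrable_apply hb i).continuousOn_mul (hc _ (intervalIntegrable_apply ha i)))
  have key : ∀ i, ∫ t in (0 : ℝ)..τ, (a t i * (β 0 i + ∫ s in (0 : ℝ)..t, b s i)
      + (α 0 i + ∫ s in (0 : ℝ)..t, a s i) * b t i) = α τ i * β τ i - α 0 i * β 0 i := by
    intro i
    rw [integral_mul_primitive _ _ (intervalIntegrable_apply ha i) (intervalIntegrable_apply hb i),
      ← hcoord ha hα i τ hτ', ← hcoord hb hβ i τ hτ']
  simp only [dotProduct]
  rw [← Finset.sum_sub_distrib, ← Finset.sum_congr rfl fun i _ => key i,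
    ← intervalIntegral.integral_finsetSum fun i _ => hInt i]
  refine intervalIntegral.integral_congr fun t ht => ?_
  rw [Set.uIcc_of_le hτ] at ht
  rw [← Finset.sum_add_distrib]
  refine Finset.sum_congr rfl fun i _ => ?_
  rw [hcoord ha hα i t ht, hcoord hb hβ i t ht]

/-! ### Trajectories of `d(Ew)/dt = G w` -/

section Trajectory

set_option linter.unusedSectionVars false

variable {W X : Type*} [NormedAddCommGroup W] [InnerProductSpace ℝ W] [CompleteSpace W]
  [NormedAddCommGroup X] [NormedSpace ℝ X] [CompleteSpace X]

theorem MemLp.mono_Icc {V : Type*} [NormedAddCommGroup V] {w : ℝ → V} {T a b : ℝ}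
    (hw : MemLp w 2 (volume.restrict (Set.Icc 0 T))) (ha : 0 ≤ a) (hb : b ≤ T) :
    MemLp w 2 (volume.restrict (Set.Icc a b)) :=
  hw.mono_measure (Measure.restrict_mono (Set.Icc_subset_Icc ha hb) le_rfl)

theorem MemLp.intervalIntegrable_of_Icc {V : Type*} [NormedAddCommGroup V] {w : ℝ → V} {T a b : ℝ}
    (hw : MemLp w 2 (volume.restrict (Set.Icc 0 T))) (ha : a ∈ Set.Icc 0 T)
    (hb : b ∈ Set.Icc 0 T) : IntervalIntegrable w volume a b := by
  have h : IntegrableOn w (Set.Icc 0 T) := hw.integrable one_le_two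
  exact (h.mono_set ((Set.uIcc_subset_Icc ha hb))).intervalIntegrable

theorem intervalIntegrable_clm_comp {V V' : Type*} [NormedAddCommGroup V] [NormedSpace ℝ V]
    [NormedAddCommGroup V'] [NormedSpace ℝ V'] (G : V →L[ℝ] V') {w : ℝ → V} {a b : ℝ}
    (hw : IntervalIntegrable w volume a b) :
    IntervalIntegrable (fun s => G (w s)) volume a b :=
  ⟨G.integrable_comp hw.1, G.integrable_comp hw.2⟩

theorem MemLp.intervalIntegrable_norm_sq {V : Type*} [NormedAddCommGroup V] {w : ℝ → V}
    {T a b : ℝ} (hw : MemLp w 2 (volume.restrict (Set.Icc 0 T))) (ha : a ∈ Set.Icc 0 T)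
    (hb : b ∈ Set.Icc 0 T) : IntervalIntegrable (fun t => ‖w t‖ ^ 2) volume a b := by
  have h : IntegrableOn (fun t => ‖w t‖ ^ 2) (Set.Icc 0 T) :=
    hw.integrable_norm_pow (p := 2) (by norm_num)
  exact (h.mono_set ((Set.uIcc_subset_Icc ha hb))).intervalIntegrable

/-- The state at time `t` of the trajectory `w` with initial state `x₀`. -/
noncomputable def trajState (G : W →L[ℝ] X) (x₀ : X) (w : ℝ → W) (t : ℝ) : X :=
  x₀ + ∫ s in (0 : ℝ)..t, G (w s)

/-- `w` is a trajectory of `d(Ew)/dt = G w` on `I` with initial state `x₀`, up to modification on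
a null set. -/
def IsTrajectory (E G : W →L[ℝ] X) (x₀ : X) (I : Set ℝ) (w : ℝ → W) : Prop :=
  ∀ᵐ t ∂(volume.restrict I), E (w t) = trajState G x₀ w t

variable {E G : W →L[ℝ] X} {x₀ : X}

theorem trajState_congr {w w' : ℝ → W} {t : ℝ} (ht : 0 ≤ t)
    (h : w =ᵐ[volume.restrict (Set.Icc 0 t)] w') : trajState G x₀ w t = trajState G x₀ w' t := by
  unfold trajState
  congr 1
  refine intervalIntegral.integral_congr_ae ?_
  rw [Set.uIoc_of_le ht]
  have := (ae_restrict_iff' measurableSet_Icc).1 h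
  filter_upwards [this] with s hs hst
  rw [hs ⟨hst.1.le, hst.2⟩]

/-- Being a trajectory depends only on the almost everywhere class, so it is a condition on elements
of L². -/
theorem IsTrajectory.congr {w w' : ℝ → W} {T : ℝ} (hw : IsTrajectory E G x₀ (Set.Icc 0 T) w)
    (h : w =ᵐ[volume.restrict (Set.Icc 0 T)] w') : IsTrajectory E G x₀ (Set.Icc 0 T) w' := by
  unfold IsTrajectory at hw ⊢
  filter_upwards [hw, h, ae_restrict_mem measurableSet_Icc] with t h1 h2 ht
  rw [← h2, h1]
  exact trajState_congr ht.1
    (ae_mono (Measure.restrict_mono (Set.Icc_subset_Icc le_rfl ht.2) le_rfl) h)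

theorem IsTrajectory.mono {w : ℝ → W} {I J : Set ℝ} (hw : IsTrajectory E G x₀ I w) (h : J ⊆ I) :
    IsTrajectory E G x₀ J w :=
  ae_mono (Measure.restrict_mono h le_rfl) hw

theorem trajState_add {x₁ x₂ : X} {w₁ w₂ : ℝ → W} {t : ℝ}
    (h₁ : IntervalIntegrable w₁ volume 0 t) (h₂ : IntervalIntegrable w₂ volume 0 t) :
    trajState G (x₁ + x₂) (w₁ + w₂) t = trajState G x₁ w₁ t + trajState G x₂ w₂ t := by
  simp only [trajState, Pi.add_apply, map_add]
  rw [intervalIntegral.integral_add (intervalIntegrable_clm_comp G h₁)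
    (intervalIntegrable_clm_comp G h₂)]
  abel

theorem trajState_smul {x : X} {w : ℝ → W} {t : ℝ} (c : ℝ) :
    trajState G (c • x) (c • w) t = c • trajState G x w t := by
  simp only [trajState, Pi.smul_apply, map_smul, intervalIntegral.integral_smul, smul_add]

theorem trajState_eq_add {w : ℝ → W} {s t : ℝ} (h₁ : IntervalIntegrable w volume 0 s)
    (h₂ : IntervalIntegrable w volume s t) :
    trajState G x₀ w t = trajState G x₀ w s + ∫ r in s..t, G (w r) := by
  unfold trajState
  rw [add_assoc, intervalIntegral.integral_add_adjacent_intervals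
    (intervalIntegrable_clm_comp G h₁) (intervalIntegrable_clm_comp G h₂)]

theorem ae_restrict_Icc_sub {P : ℝ → Prop} {a b : ℝ}
    (h : ∀ᵐ t ∂(volume.restrict (Set.Icc 0 b)), P t) :
    ∀ᵐ t ∂(volume.restrict (Set.Icc a (a + b))), P (t - a) := by
  have hmp := (measurePreserving_sub_right (volume : Measure ℝ) a).restrict_preimage
    (measurableSet_Icc (a := 0) (b := b))
  rw [show (fun x => x - a) ⁻¹' Set.Icc 0 b = Set.Icc a (a + b) by
    rw [Set.preimage_sub_const_Icc, zero_add, add_comm]] at hmp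
  exact hmp.quasiMeasurePreserving.ae h

theorem MemLp.comp_sub_Icc {w : ℝ → W} {a b : ℝ}
    (hw : MemLp w 2 (volume.restrict (Set.Icc 0 b))) :
    MemLp (fun t => w (t - a)) 2 (volume.restrict (Set.Icc a (a + b))) := by
  have hmp := (measurePreserving_sub_right (volume : Measure ℝ) a).restrict_preimage
    (measurableSet_Icc (a := 0) (b := b))
  rw [show (fun x => x - a) ⁻¹' Set.Icc 0 b = Set.Icc a (a + b) by
    rw [Set.preimage_sub_const_Icc, zero_add, add_comm]] at hmp
  exact hw.comp_measurePreserving hmp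

/-- Concatenation of two trajectories. -/
theorem exists_concat {w₁ w₂ : ℝ → W} {a b : ℝ} (ha : 0 ≤ a) (hb : 0 ≤ b)
    (hm₁ : MemLp w₁ 2 (volume.restrict (Set.Icc 0 a)))
    (hm₂ : MemLp w₂ 2 (volume.restrict (Set.Icc 0 b)))
    (h₁ : IsTrajectory E G x₀ (Set.Icc 0 a) w₁)
    (h₂ : IsTrajectory E G (trajState G x₀ w₁ a) (Set.Icc 0 b) w₂) :
    ∃ w : ℝ → W, MemLp w 2 (volume.restrict (Set.Icc 0 (a + b))) ∧
      IsTrajectory E G x₀ (Set.Icc 0 (a + b)) w ∧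
      ∫ t in (0 : ℝ)..(a + b), ‖w t‖ ^ 2
        = (∫ t in (0 : ℝ)..a, ‖w₁ t‖ ^ 2) + ∫ t in (0 : ℝ)..b, ‖w₂ t‖ ^ 2 := by
  set w : ℝ → W := (Set.Iic a).piecewise w₁ (fun t => w₂ (t - a)) with hw
  have hle : ∀ t, t ≤ a → w t = w₁ t := fun t ht => Set.piecewise_eq_of_mem _ _ _ ht
  have hgt : ∀ t, a < t → w t = w₂ (t - a) := fun t ht =>
    Set.piecewise_eq_of_notMem _ _ _ (by simpa using ht)
  have hm : MemLp w 2 (volume.restrict (Set.Icc 0 (a + b))) := by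
    refine MemLp.piecewise measurableSet_Iic ?_ ?_
    · rw [Measure.restrict_restrict measurableSet_Iic]
      exact hm₁.mono_measure (Measure.restrict_mono
        (show Set.Iic a ∩ Set.Icc 0 (a + b) ⊆ Set.Icc 0 a from fun t ht => ⟨ht.2.1, ht.1⟩) le_rfl)
    · rw [Measure.restrict_restrict measurableSet_Iic.compl]
      refine (MemLp.comp_sub_Icc hm₂).mono_measure (Measure.restrict_mono
        (show (Set.Iic a)ᶜ ∩ Set.Icc 0 (a + b) ⊆ Set.Icc a (a + b) from fun t ht => ?_) le_rfl)
      have : a < t := by simpa using ht.1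
      exact ⟨this.le, ht.2.2⟩
  have hstate : ∀ t, 0 ≤ t → t ≤ a → trajState G x₀ w t = trajState G x₀ w₁ t := by
    intro t h0 hta
    refine trajState_congr h0 ?_
    filter_upwards [ae_restrict_mem measurableSet_Icc] with s hs using hle s (hs.2.trans hta)
  have hia : IntervalIntegrable w volume 0 a :=
    MemLp.intervalIntegrable_of_Icc hm ⟨le_rfl, by linarith⟩ ⟨ha, by linarith⟩
  refine ⟨w, hm, ?_, ?_⟩
  · have e1 := (ae_restrict_iff' measurableSet_Icc).1 h₁
    have e2 := (ae_restrict_iff' measurableSet_Icc).1 (ae_restrict_Icc_sub (a := a) h₂)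
    refine (ae_restrict_iff' measurableSet_Icc).2 ?_
    filter_upwards [e1, e2] with t h1 h2 ht
    rcases le_or_gt t a with hta | hta
    · rw [hle t hta, hstate t ht.1 hta]
      exact h1 ⟨ht.1, hta⟩
    · have hit : IntervalIntegrable w volume a t :=
        MemLp.intervalIntegrable_of_Icc hm ⟨ha, by linarith⟩ ht
      rw [hgt t hta, h2 ⟨hta.le, ht.2⟩, trajState_eq_add hia hit, hstate a ha le_rfl]
      conv_lhs => unfold trajState
      congr 1
      -- Time shift by `a`: the drift of `w` over `[a, t]` is the drift of `w₂` over `[0, t - a]`.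
      rw [← sub_self a, ← intervalIntegral.integral_comp_sub_right (fun s => G (w₂ s)) a]
      refine intervalIntegral.integral_congr_ae (Eventually.of_forall fun s hs => ?_)
      rw [Set.uIoc_of_le hta.le] at hs
      rw [hgt s hs.1]
  · rw [← intervalIntegral.integral_add_adjacent_intervals
      (MemLp.intervalIntegrable_norm_sq hm ⟨le_rfl, by linarith⟩ (b := a) ⟨ha, by linarith⟩)
      (MemLp.intervalIntegrable_norm_sq hm ⟨ha, by linarith⟩ ⟨by linarith, le_rfl⟩)]
    congr 1
    · refine intervalIntegral.integral_congr fun s hs => ?_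
      rw [Set.uIcc_of_le ha] at hs
      simp only [hle s hs.2]
    · have := intervalIntegral.integral_comp_sub_right (a := a) (b := a + b)
        (fun s => ‖w₂ s‖ ^ 2) a
      rw [sub_self, add_sub_cancel_left] at this
      rw [← this]
      refine intervalIntegral.integral_congr_ae (Eventually.of_forall fun s hs => ?_)
      rw [Set.uIoc_of_le (by linarith)] at hs
      rw [hgt s hs.1]

theorem MemLp.norm_toLp_sq {α V : Type*} [MeasurableSpace α] {μ : Measure α}
    [NormedAddCommGroup V] [InnerProductSpace ℝ V] {w : α → V} (hw : MemLp w 2 μ) :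
    ‖hw.toLp w‖ ^ 2 = ∫ t, ‖w t‖ ^ 2 ∂μ := by
  rw [← real_inner_self_eq_norm_sq, L2.inner_def]
  refine integral_congr_ae ?_
  filter_upwards [hw.coeFn_toLp] with t ht
  rw [ht, real_inner_self_eq_norm_sq]

/-- On a bounded interval L² convergence implies L¹ convergence, so states at a fixed time pass to
the limit. -/
theorem tendsto_intervalIntegral_of_tendsto_Lp (G : W →L[ℝ] X)
    {s : ℕ → Lp W 2 (volume.restrict (Set.Ici (0 : ℝ)))}
    {k : Lp W 2 (volume.restrict (Set.Ici (0 : ℝ)))} (h : Tendsto s atTop (𝓝 k)) {t : ℝ}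
    (ht : 0 ≤ t) :
    Tendsto (fun N => ∫ r in (0 : ℝ)..t, G (s N r)) atTop (𝓝 (∫ r in (0 : ℝ)..t, G (k r))) := by
  have hsub : Set.Icc 0 t ⊆ Set.Ici 0 := Set.Icc_subset_Ici_self
  have hm : ∀ f : Lp W 2 (volume.restrict (Set.Ici (0 : ℝ))),
      MemLp f 2 (volume.restrict (Set.Icc 0 t)) := fun f =>
    (Lp.memLp f).mono_measure (Measure.restrict_mono hsub le_rfl)
  have hi : ∀ f : Lp W 2 (volume.restrict (Set.Ici (0 : ℝ))),
      IntervalIntegrable f volume 0 t := fun f =>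
    MemLp.intervalIntegrable_of_Icc (hm f) ⟨le_rfl, ht⟩ ⟨ht, le_rfl⟩
  have hmain : Tendsto (fun N => ∫ r in Set.Icc 0 t, s N r) atTop
      (𝓝 (∫ r in Set.Icc 0 t, k r)) := by
    refine tendsto_integral_of_L1' _ ((hm k).integrable one_le_two).aestronglyMeasurable
      (Eventually.of_forall fun N => (hm (s N)).integrable one_le_two) ?_
    have hlp := (Lp.tendsto_Lp_iff_tendsto_eLpNorm' s k).1 h
    have hlp' : Tendsto (fun N => eLpNorm (⇑(s N) - ⇑k) 2 (volume.restrict (Set.Ici 0))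
        * (volume.restrict (Set.Icc 0 t)) Set.univ ^ (1 / (1 : ENNReal).toReal
          - 1 / (2 : ENNReal).toReal)) atTop (𝓝 0) := by
      have := ENNReal.Tendsto.mul_const hlp (b := (volume.restrict (Set.Icc 0 t)) Set.univ ^
        (1 / (1 : ENNReal).toReal - 1 / (2 : ENNReal).toReal)) (Or.inr ?_)
      · simpa using this
      · refine ENNReal.rpow_ne_top_of_nonneg (by norm_num) (by simp)
    refine tendsto_of_tendsto_of_tendsto_of_le_of_le tendsto_const_nhds hlp'
      (fun _ => zero_le) fun N => ?_
    refine (eLpNorm_le_eLpNorm_mul_rpow_measure_univ one_le_two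
      ((hm (s N)).sub (hm k)).aestronglyMeasurable).trans ?_
    gcongr
  simp only [intervalIntegral.integral_of_le ht, ← integral_Icc_eq_integral_Ioc]
  have hG : ∀ f : Lp W 2 (volume.restrict (Set.Ici (0 : ℝ))),
      ∫ r in Set.Icc 0 t, G (f r) = G (∫ r in Set.Icc 0 t, f r) := fun f =>
    G.integral_comp_comm ((hm f).integrable one_le_two)
  simp only [hG]
  exact (G.continuous.tendsto _).comp hmain

/-- If the running cost can be kept bounded on all intervals `[0, N]`, some square integrable
trajectory on `[0, ∞)` has as its cost the supremum of the optimal costs on these intervals. -/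
theorem exists_optimal_trajectory (c : ℝ)
    (h : ∀ N : ℕ, ∃ w : ℝ → W, MemLp w 2 (volume.restrict (Set.Icc 0 (N : ℝ))) ∧
      IsTrajectory E G x₀ (Set.Icc 0 (N : ℝ)) w ∧ ∫ t in (0 : ℝ)..N, ‖w t‖ ^ 2 ≤ c) :
    ∃ w : ℝ → W, MemLp w 2 (volume.restrict (Set.Ici 0)) ∧
      IsTrajectory E G x₀ (Set.Ici 0) w ∧
      ∀ b < ∫ t in Set.Ioi (0 : ℝ), ‖w t‖ ^ 2, ∃ N : ℕ, ∀ w' : ℝ → W,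
        MemLp w' 2 (volume.restrict (Set.Icc 0 (N : ℝ))) →
        IsTrajectory E G x₀ (Set.Icc 0 (N : ℝ)) w' → b < ∫ t in (0 : ℝ)..N, ‖w' t‖ ^ 2 := by
  -- Nothing is required after time `N`. All these sets therefore lie in one Hilbert space and
  -- decrease with `N`, and extension by zero identifies the least squared norm in `C N` with the
  -- optimal cost on `[0, N]`.
  set C : ℕ → Set (Lp W 2 (volume.restrict (Set.Ici (0 : ℝ)))) :=
    fun N => {k | IsTrajectory E G x₀ (Set.Icc 0 (N : ℝ)) k} with hC
  have hmem : ∀ (f : Lp W 2 (volume.restrict (Set.Ici (0 : ℝ)))) (T : ℝ),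
      MemLp f 2 (volume.restrict (Set.Icc 0 T)) := fun f T =>
    (Lp.memLp f).mono_measure (Measure.restrict_mono Set.Icc_subset_Ici_self le_rfl)
  have hext : ∀ (N : ℕ) (w : ℝ → W), MemLp w 2 (volume.restrict (Set.Icc 0 (N : ℝ))) →
      IsTrajectory E G x₀ (Set.Icc 0 (N : ℝ)) w →
      ∃ k ∈ C N, ‖k‖ ^ 2 = ∫ t in (0 : ℝ)..N, ‖w t‖ ^ 2 := by
    intro N w hm ht
    have hrr : (volume.restrict (Set.Ici (0 : ℝ))).restrict (Set.Icc 0 (N : ℝ))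
        = volume.restrict (Set.Icc 0 (N : ℝ)) :=
      Measure.restrict_restrict_of_subset Set.Icc_subset_Ici_self
    have hind : MemLp ((Set.Icc 0 (N : ℝ)).indicator w) 2 (volume.restrict (Set.Ici (0 : ℝ))) := by
      rw [memLp_indicator_iff_restrict measurableSet_Icc, hrr]
      exact hm
    refine ⟨hind.toLp _, ?_, ?_⟩
    · refine IsTrajectory.congr ht ?_
      filter_upwards [ae_mono (Measure.restrict_mono (Set.Icc_subset_Ici_self) le_rfl)
        hind.coeFn_toLp, ae_restrict_mem measurableSet_Icc] with t h1 h2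
      rw [h1, Set.indicator_of_mem h2]
    · rw [MemLp.norm_toLp_sq, intervalIntegral.integral_of_le (Nat.cast_nonneg N),
        ← integral_Icc_eq_integral_Ioc, ← hrr, ← integral_indicator measurableSet_Icc]
      refine integral_congr_ae (Eventually.of_forall fun t => ?_)
      by_cases h : t ∈ Set.Icc 0 (N : ℝ) <;> simp [h]
  obtain ⟨k, ⟨s, hsC, hsk⟩, hk⟩ := exists_limit_of_antitone_midpoint C
    (fun N M hNM k hk => IsTrajectory.mono hk
      (Set.Icc_subset_Icc le_rfl (by exact_mod_cast hNM)))
    (fun N x hx y hy => by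
      have e1 : ⇑((1 / 2 : ℝ) • (x + y)) =ᵐ[volume.restrict (Set.Icc 0 (N : ℝ))]
          (1 / 2 : ℝ) • (⇑x + ⇑y) := by
        refine ae_mono (Measure.restrict_mono (Set.Icc_subset_Ici_self) le_rfl) ?_
        filter_upwards [Lp.coeFn_smul (1 / 2 : ℝ) (x + y), Lp.coeFn_add x y] with t h1 h2
        simp only [h1, Pi.smul_apply, h2, Pi.add_apply]
      refine IsTrajectory.congr ?_ e1.symm
      unfold IsTrajectory
      filter_upwards [hx, hy, ae_restrict_mem measurableSet_Icc] with t h1 h2 ht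
      have ht0 : (0 : ℝ) ∈ Set.Icc 0 (N : ℝ) := ⟨le_rfl, Nat.cast_nonneg N⟩
      have h3 : x₀ = (1 / 2 : ℝ) • (x₀ + x₀) := by
        rw [← two_smul ℝ x₀, smul_smul]; norm_num
      rw [h3, trajState_smul, trajState_add
        (MemLp.intervalIntegrable_of_Icc (hmem x N) ht0 ht)
        (MemLp.intervalIntegrable_of_Icc (hmem y N) ht0 ht)]
      rw [← h1, ← h2]
      simp)
    c (fun N => by
      obtain ⟨w, hm, ht, hc⟩ := h N
      obtain ⟨k, hk, hk'⟩ := hext N w hm ht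
      exact ⟨k, hk, hk'.trans_le hc⟩)
  have hnorm : ‖k‖ ^ 2 = ∫ t in Set.Ioi (0 : ℝ), ‖k t‖ ^ 2 := by
    rw [← integral_Ici_eq_integral_Ioi, ← MemLp.norm_toLp_sq (Lp.memLp k), Lp.toLp_coeFn]
  refine ⟨k, Lp.memLp k, ?_, fun b hb => ?_⟩
  -- `E (w t)` is a pointwise value, which L² convergence does not control. An almost everywhere
  -- convergent subsequence handles it, while the state converges at every `t`.
  · obtain ⟨ns, hns, hae⟩ := (tendstoInMeasure_of_tendsto_Lp hsk).exists_seq_tendsto_ae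
    have hall : ∀ᵐ t, ∀ N : ℕ, t ∈ Set.Icc 0 (N : ℝ) →
        E (s N t) = trajState G x₀ (s N) t := by
      rw [ae_all_iff]
      exact fun N => (ae_restrict_iff' measurableSet_Icc).1 (hsC N)
    unfold IsTrajectory
    filter_upwards [hae, ae_restrict_of_ae hall, ae_restrict_mem measurableSet_Ici] with t h1 h2 h3
    have l1 : Tendsto (fun j => E (s (ns j) t)) atTop (𝓝 (E (k t))) :=
      (E.continuous.tendsto _).comp h1
    have l2 : Tendsto (fun j => trajState G x₀ (s (ns j)) t) atTop (𝓝 (trajState G x₀ k t)) :=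
      ((tendsto_intervalIntegral_of_tendsto_Lp G hsk h3).const_add x₀).comp hns.tendsto_atTop
    refine tendsto_nhds_unique l1 (l2.congr' ?_)
    filter_upwards [(tendsto_natCast_atTop_atTop.comp hns.tendsto_atTop).eventually_ge_atTop t]
      with j hj
    exact (h2 (ns j) ⟨h3, hj⟩).symm
  · rw [← hnorm] at hb
    obtain ⟨N, hN⟩ := hk b hb
    refine ⟨N, fun w' hm ht => ?_⟩
    obtain ⟨k', hk', hk''⟩ := hext N w' hm ht
    rw [← hk'']
    exact hN k' hk'

end Trajectory

/-! ### Decay of square integrable trajectories, and bounded cost from a decaying one -/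

section Decay

set_option linter.unusedSectionVars false

variable {W X : Type*} [NormedAddCommGroup W] [InnerProductSpace ℝ W] [CompleteSpace W]
  [NormedAddCommGroup X] [NormedSpace ℝ X] [CompleteSpace X] {E G : W →L[ℝ] X} {x₀ : X}

/-- The state of a square integrable trajectory on `[0, ∞)` tends to zero. -/
theorem tendsto_trajState_of_memLp {w : ℝ → W} (hm : MemLp w 2 (volume.restrict (Set.Ici 0)))
    (hw : IsTrajectory E G x₀ (Set.Ici 0) w) : Tendsto (trajState G x₀ w) atTop (𝓝 0) := by
  have hmT : ∀ T, MemLp w 2 (volume.restrict (Set.Icc 0 T)) := fun T =>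
    hm.mono_measure (Measure.restrict_mono Set.Icc_subset_Ici_self le_rfl)
  have hi : ∀ {a b : ℝ}, 0 ≤ a → 0 ≤ b → IntervalIntegrable w volume a b := fun {a b} ha hb =>
    MemLp.intervalIntegrable_of_Icc (hmT (max a b)) ⟨ha, le_max_left _ _⟩ ⟨hb, le_max_right _ _⟩
  have hi2 : ∀ {a b : ℝ}, 0 ≤ a → 0 ≤ b → IntervalIntegrable (fun t => ‖w t‖ ^ 2) volume a b :=
    fun {a b} ha hb => MemLp.intervalIntegrable_norm_sq (hmT (max a b)) ⟨ha, le_max_left _ _⟩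
      ⟨hb, le_max_right _ _⟩
  have hsq : Tendsto (fun t => ∫ s in t..(t + 1), ‖w s‖ ^ 2) atTop (𝓝 0) := by
    have hInt : IntegrableOn (fun t => ‖w t‖ ^ 2) (Set.Ioi 0) :=
      (hm.integrable_norm_pow (p := 2) (by norm_num)).mono_measure
        (Measure.restrict_mono Set.Ioi_subset_Ici_self le_rfl)
    have h1 := intervalIntegral_tendsto_integral_Ioi 0 hInt tendsto_id
    have h2 := intervalIntegral_tendsto_integral_Ioi 0 hInt (tendsto_id.atTop_add
      (tendsto_const_nhds (x := (1 : ℝ))))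
    have h3 := h2.sub h1
    rw [sub_self] at h3
    refine h3.congr' ?_
    filter_upwards [eventually_ge_atTop 0] with t ht
    exact intervalIntegral.integral_interval_sub_left (hi2 le_rfl (by simp; linarith))
      (hi2 le_rfl ht)
  have hone : Tendsto (fun t => ∫ s in t..(t + 1), ‖w s‖) atTop (𝓝 0) := by
    rw [Metric.tendsto_nhds]
    intro ε hε
    filter_upwards [eventually_ge_atTop 0, hsq.eventually_lt_const (show (0 : ℝ) < ε ^ 2 by
      positivity)] with t ht hlt
    -- Young's inequality `‖w‖ ≤ ε/2 + ‖w‖²/(2ε)` on a window of length one.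
    have hmono : ∫ s in t..(t + 1), ‖w s‖ ≤ ∫ s in t..(t + 1), (ε / 2 + ‖w s‖ ^ 2 / (2 * ε)) := by
      refine intervalIntegral.integral_mono_on (by linarith) (hi ht (by linarith)).norm
        (intervalIntegrable_const.add ((hi2 ht (by linarith)).div_const _)) fun s _ => ?_
      have h0 : 0 ≤ (ε - ‖w s‖) ^ 2 / (2 * ε) := by positivity
      have h1 : (ε - ‖w s‖) ^ 2 / (2 * ε) = ε / 2 + ‖w s‖ ^ 2 / (2 * ε) - ‖w s‖ := by
        field_simp; ring
      linarith
    rw [intervalIntegral.integral_add intervalIntegrable_const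
      ((hi2 ht (by linarith)).div_const _), intervalIntegral.integral_const,
      intervalIntegral.integral_div] at hmono
    have hnn : 0 ≤ ∫ s in t..(t + 1), ‖w s‖ :=
      intervalIntegral.integral_nonneg (by linarith) fun _ _ => norm_nonneg _
    have h2 : (∫ s in t..(t + 1), ‖w s‖ ^ 2) / (2 * ε) < ε / 2 := by
      rw [div_lt_iff₀ (by positivity)]; nlinarith
    rw [Real.dist_eq, sub_zero, abs_of_nonneg hnn]
    simp only [add_sub_cancel_left, one_smul] at hmono
    linarith
  have hbound : ∀ᶠ t in atTop,
      ‖trajState G x₀ w t‖ ≤ (‖E‖ + ‖G‖) * ∫ s in t..(t + 1), ‖w s‖ := by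
    filter_upwards [eventually_ge_atTop 0] with t ht
    -- The value of `w` at a single time is uncontrolled. The state at `t` is therefore compared
    -- with `E (w s)` for almost every `s` in the window, and the inequality is then averaged over
    -- `s`.
    have hae : ∀ᵐ s ∂(volume.restrict (Set.Icc t (t + 1))),
        ‖trajState G x₀ w t‖ ≤ ‖E‖ * ‖w s‖ + ‖G‖ * ∫ r in t..(t + 1), ‖w r‖ := by
      have hw' := ae_mono (Measure.restrict_mono
        (show Set.Icc t (t + 1) ⊆ Set.Ici 0 from fun s hs => ht.trans hs.1) le_rfl) hw
      filter_upwards [hw', ae_restrict_mem measurableSet_Icc] with s hs hst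
      have hs0 : 0 ≤ s := ht.trans hst.1
      have e := trajState_eq_add (G := G) (x₀ := x₀) (hi le_rfl ht) (hi ht hs0)
      rw [← hs] at e
      have e2 : ‖∫ r in t..s, G (w r)‖ ≤ ‖G‖ * ∫ r in t..(t + 1), ‖w r‖ := by
        calc ‖∫ r in t..s, G (w r)‖ ≤ ∫ r in t..s, ‖G‖ * ‖w r‖ :=
              intervalIntegral.norm_integral_le_of_norm_le hst.1
                (Eventually.of_forall fun r _ => G.le_opNorm _)
                ((hi ht hs0).norm.const_mul _)
          _ = ‖G‖ * ∫ r in t..s, ‖w r‖ := intervalIntegral.integral_const_mul _ _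
          _ ≤ ‖G‖ * ∫ r in t..(t + 1), ‖w r‖ := by
              gcongr
              exact intervalIntegral.integral_mono_interval le_rfl hst.1 hst.2
                (Eventually.of_forall fun _ => norm_nonneg _) (hi ht (by linarith)).norm
      calc ‖trajState G x₀ w t‖ = ‖E (w s) - ∫ r in t..s, G (w r)‖ := by rw [e]; simp
        _ ≤ ‖E (w s)‖ + ‖∫ r in t..s, G (w r)‖ := norm_sub_le _ _
        _ ≤ _ := add_le_add (E.le_opNorm _) e2
    have hmono := intervalIntegral.integral_mono_ae_restrict (show t ≤ t + 1 by linarith)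
      intervalIntegrable_const
      (((hi ht (by linarith : (0 : ℝ) ≤ t + 1)).norm.const_mul ‖E‖).add
        (intervalIntegrable_const (c := ‖G‖ * ∫ r in t..(t + 1), ‖w r‖))) hae
    rw [intervalIntegral.integral_add ((hi ht (by linarith)).norm.const_mul ‖E‖)
      intervalIntegrable_const, intervalIntegral.integral_const, intervalIntegral.integral_const,
      intervalIntegral.integral_const_mul] at hmono
    simp only [add_sub_cancel_left, one_smul] at hmono
    linarith
  refine squeeze_zero_norm' hbound ?_
  simpa using hone.const_mul (‖E‖ + ‖G‖)

variable (E G) in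
/-- The trajectories on `[0, ∞)`, together with their initial states, whose state tends to zero. -/
def decayingTrajectories : Submodule ℝ (X × (ℝ → W)) where
  carrier := {z | (∀ T, MemLp z.2 2 (volume.restrict (Set.Icc 0 T))) ∧
    IsTrajectory E G z.1 (Set.Ici 0) z.2 ∧ Tendsto (trajState G z.1 z.2) atTop (𝓝 0)}
  zero_mem' := by
    have : ∀ t, trajState G (0 : X) (0 : ℝ → W) t = 0 := fun t => by simp [trajState]
    refine ⟨fun T => MemLp.zero, ?_, ?_⟩
    · exact Eventually.of_forall fun t => by simp [this]
    · exact tendsto_const_nhds.congr fun t => (this t).symm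
  add_mem' := by
    rintro ⟨x, w⟩ ⟨x', w'⟩ ⟨h1, h2, h3⟩ ⟨h1', h2', h3'⟩
    have hadd : ∀ t, 0 ≤ t →
        trajState G (x + x') (w + w') t = trajState G x w t + trajState G x' w' t := fun t ht =>
      trajState_add (MemLp.intervalIntegrable_of_Icc (h1 t) ⟨le_rfl, ht⟩ ⟨ht, le_rfl⟩)
        (MemLp.intervalIntegrable_of_Icc (h1' t) ⟨le_rfl, ht⟩ ⟨ht, le_rfl⟩)
    refine ⟨fun T => (h1 T).add (h1' T), ?_, ?_⟩
    · change ∀ᵐ t ∂_, E ((w + w') t) = trajState G (x + x') (w + w') t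
      filter_upwards [h2, h2', ae_restrict_mem measurableSet_Ici] with t e1 e2 ht
      rw [hadd t ht, Pi.add_apply, map_add, e1, e2]
    · have h := h3.add h3'
      rw [add_zero] at h
      refine h.congr' ?_
      filter_upwards [eventually_ge_atTop 0] with t ht
      exact (hadd t ht).symm
  smul_mem' := by
    rintro c ⟨x, w⟩ ⟨h1, h2, h3⟩
    refine ⟨fun T => (h1 T).const_smul c, ?_, ?_⟩
    · change ∀ᵐ t ∂_, E ((c • w) t) = trajState G (c • x) (c • w) t
      filter_upwards [h2] with t e1
      rw [trajState_smul, Pi.smul_apply, map_smul, e1]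
    · have h := h3.const_smul c
      rw [smul_zero] at h
      exact h.congr fun t => trajState_smul c |>.symm

/-- This permits iteration: the state reached at time `T` is again the initial state of a decaying
trajectory. -/
theorem decayingTrajectories_shift {x : X} {w : ℝ → W} (h : (x, w) ∈ decayingTrajectories E G)
    {T : ℝ} (hT : 0 ≤ T) :
    (trajState G x w T, fun t => w (t + T)) ∈ decayingTrajectories E G := by
  obtain ⟨h1, h2, h3⟩ := h
  simp only at h1 h2 h3
  have hstate : ∀ t, 0 ≤ t →
      trajState G (trajState G x w T) (fun t => w (t + T)) t = trajState G x w (t + T) := by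
    intro t ht
    rw [trajState_eq_add (MemLp.intervalIntegrable_of_Icc (h1 (t + T)) ⟨le_rfl, by linarith⟩
      ⟨hT, by linarith⟩) (MemLp.intervalIntegrable_of_Icc (h1 (t + T)) ⟨hT, by linarith⟩
      ⟨by linarith, le_rfl⟩)]
    conv_lhs => unfold trajState
    congr 1
    have := intervalIntegral.integral_comp_add_right (a := 0) (b := t) (fun s => G (w s)) T
    rw [this, zero_add]
  refine ⟨fun S => ?_, ?_, ?_⟩
  · have hmp := (measurePreserving_add_right (volume : Measure ℝ) T).restrict_preimage
      (measurableSet_Icc (a := T) (b := S + T))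
    rw [show (fun x => x + T) ⁻¹' Set.Icc T (S + T) = Set.Icc 0 S by
      rw [Set.preimage_add_const_Icc, sub_self, add_sub_cancel_right]] at hmp
    exact (MemLp.mono_Icc (h1 (S + T)) hT le_rfl).comp_measurePreserving hmp
  · have hmp := (measurePreserving_add_right (volume : Measure ℝ) T).restrict_preimage
      (measurableSet_Ici (a := T))
    rw [show (fun x => x + T) ⁻¹' Set.Ici T = Set.Ici 0 by
      rw [Set.preimage_add_const_Ici, sub_self]] at hmp
    have := hmp.quasiMeasurePreserving.ae (h2.mono (Set.Ici_subset_Ici.2 hT))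
    change ∀ᵐ t ∂_, E (w (t + T)) = _
    filter_upwards [this, ae_restrict_mem measurableSet_Ici] with t e ht
    rw [hstate t ht, e]
  · refine (h3.comp (tendsto_atTop_add_const_right atTop T tendsto_id)).congr' ?_
    filter_upwards [eventually_ge_atTop 0] with t ht
    exact (hstate t ht).symm

theorem trajState_sum {ι : Type*} (s : Finset ι) (c : ι → ℝ) (z : ι → X × (ℝ → W))
    (hz : ∀ i, z i ∈ decayingTrajectories E G) {t : ℝ} (ht : 0 ≤ t) :
    trajState G (∑ i ∈ s, c i • z i).1 (∑ i ∈ s, c i • z i).2 t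
      = ∑ i ∈ s, c i • trajState G (z i).1 (z i).2 t := by
  classical
  have hi : ∀ z ∈ decayingTrajectories E G, IntervalIntegrable z.2 volume 0 t := fun z hz =>
    MemLp.intervalIntegrable_of_Icc (hz.1 t) ⟨le_rfl, ht⟩ ⟨ht, le_rfl⟩
  induction s using Finset.induction_on with
  | empty => simp [trajState]
  | insert i s his ih =>
    rw [Finset.sum_insert his, Finset.sum_insert his, Prod.fst_add, Prod.snd_add,
      trajState_add (hi _ (Submodule.smul_mem _ _ (hz i)))
        (hi _ (Submodule.sum_mem _ fun i _ => Submodule.smul_mem _ _ (hz i))), ih,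
      Prod.smul_fst, Prod.smul_snd, trajState_smul]

/-- On the space of initial states of decaying trajectories there are a time `T` and a constant `D`
such that the state can be halved in time `T` at a cost at most `D ‖x‖²`. -/
theorem exists_halving [FiniteDimensional ℝ X] :
    ∃ T > 0, ∃ D ≥ 0, ∀ x ∈ (decayingTrajectories E G).map (LinearMap.fst ℝ X (ℝ → W)),
      ∃ w, (x, w) ∈ decayingTrajectories E G ∧ ‖trajState G x w T‖ ≤ ‖x‖ / 2 ∧
        ∫ t in (0 : ℝ)..T, ‖w t‖ ^ 2 ≤ D * ‖x‖ ^ 2 := by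
  set S := (decayingTrajectories E G).map (LinearMap.fst ℝ X (ℝ → W)) with hS
  set b := Module.finBasis ℝ S
  have hz : ∀ i, ∃ z ∈ decayingTrajectories E G, z.1 = (b i : X) := fun i => by
    obtain ⟨z, hz, hzi⟩ := (b i).2
    exact ⟨z, hz, hzi⟩
  choose z hz hzb using hz
  -- `C` bounds all coordinates in the basis `b` by the norm of the vector. Trajectories chosen for
  -- the basis vectors are combined linearly, so one time `T` and one constant serve every initial
  -- state.
  set C : ℝ := ∑ i, ‖LinearMap.toContinuousLinearMap (b.coord i)‖ with hCdef
  have hC0 : 0 ≤ C := by positivity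
  have hC : ∀ (x : S) i, |b.repr x i| ≤ C * ‖(x : X)‖ := by
    intro x i
    have h1 := (LinearMap.toContinuousLinearMap (b.coord i)).le_opNorm x
    have h2 : ‖LinearMap.toContinuousLinearMap (b.coord i)‖ ≤ C :=
      Finset.single_le_sum (f := fun i => ‖LinearMap.toContinuousLinearMap (b.coord i)‖)
        (fun _ _ => by positivity) (Finset.mem_univ i)
    calc |b.repr x i| ≤ ‖LinearMap.toContinuousLinearMap (b.coord i)‖ * ‖x‖ := h1
      _ ≤ C * ‖(x : X)‖ := by gcongr; exact le_rfl
  have hlim : Tendsto (fun t => C * ∑ i, ‖trajState G (z i).1 (z i).2 t‖) atTop (𝓝 0) := by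
    have := (tendsto_finsetSum Finset.univ fun i _ => (hz i).2.2.norm).const_mul C
    simpa using this
  obtain ⟨T, hT, hTpos⟩ := ((hlim.eventually_lt_const (show (0 : ℝ) < 1 / 2 by norm_num)).and
    (eventually_gt_atTop 0)).exists
  set g : ℝ → ℝ := fun t => ∑ i, ‖(z i).2 t‖ with hg
  have hgm : MemLp g 2 (volume.restrict (Set.Icc 0 T)) :=
    memLp_finsetSum _ fun i _ => ((hz i).1 T).norm
  refine ⟨T, hTpos, C ^ 2 * ∫ t in (0 : ℝ)..T, ‖g t‖ ^ 2, ?_, fun x hx => ?_⟩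
  · have : 0 ≤ ∫ t in (0 : ℝ)..T, ‖g t‖ ^ 2 :=
      intervalIntegral.integral_nonneg hTpos.le fun _ _ => by positivity
    positivity
  set c : Fin _ → ℝ := fun i => b.repr ⟨x, hx⟩ i with hc
  set y := ∑ i, c i • z i with hy
  have hyx : y.1 = x := by
    have := congrArg S.subtype (b.sum_repr ⟨x, hx⟩)
    rw [map_sum] at this
    rw [hy, Prod.fst_sum]
    simp only [Prod.smul_fst, hzb]
    simpa only [map_smul, Submodule.subtype_apply] using this
  have hymem : y ∈ decayingTrajectories E G :=
    Submodule.sum_mem _ fun i _ => Submodule.smul_mem _ _ (hz i)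
  have hcx : ∀ i, |c i| ≤ C * ‖x‖ := fun i => hC ⟨x, hx⟩ i
  refine ⟨y.2, ?_, ?_, ?_⟩
  · rw [← hyx]; exact hymem
  · rw [← hyx, trajState_sum _ _ _ hz hTpos.le, hyx]
    calc ‖∑ i, c i • trajState G (z i).1 (z i).2 T‖
        ≤ ∑ i, ‖c i • trajState G (z i).1 (z i).2 T‖ := norm_sum_le _ _
      _ ≤ ∑ i, C * ‖x‖ * ‖trajState G (z i).1 (z i).2 T‖ := by
          refine Finset.sum_le_sum fun i _ => ?_
          rw [norm_smul, Real.norm_eq_abs]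
          gcongr
          exact hcx i
      _ = ‖x‖ * (C * ∑ i, ‖trajState G (z i).1 (z i).2 T‖) := by
          rw [← Finset.mul_sum]; ring
      _ ≤ ‖x‖ * (1 / 2) := by gcongr
      _ = ‖x‖ / 2 := by ring
  · have hpt : ∀ t, ‖y.2 t‖ ^ 2 ≤ (C * ‖x‖) ^ 2 * ‖g t‖ ^ 2 := by
      intro t
      rw [← mul_pow]
      refine pow_le_pow_left₀ (norm_nonneg _) ?_ 2
      have : y.2 t = ∑ i, c i • (z i).2 t := by
        rw [hy, Prod.snd_sum, Finset.sum_apply]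
        rfl
      rw [this, Real.norm_of_nonneg (Finset.sum_nonneg fun _ _ => norm_nonneg _), Finset.mul_sum]
      refine (norm_sum_le _ _).trans (Finset.sum_le_sum fun i _ => ?_)
      rw [norm_smul, Real.norm_eq_abs]
      gcongr
      exact hcx i
    have h0 : (0 : ℝ) ∈ Set.Icc 0 T := ⟨le_rfl, hTpos.le⟩
    have h1 : T ∈ Set.Icc 0 T := ⟨hTpos.le, le_rfl⟩
    calc ∫ t in (0 : ℝ)..T, ‖y.2 t‖ ^ 2
        ≤ ∫ t in (0 : ℝ)..T, (C * ‖x‖) ^ 2 * ‖g t‖ ^ 2 :=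
          intervalIntegral.integral_mono_on hTpos.le
            (MemLp.intervalIntegrable_norm_sq (hymem.1 T) h0 h1)
            ((MemLp.intervalIntegrable_norm_sq hgm h0 h1).const_mul _) fun t _ => hpt t
      _ = (C * ‖x‖) ^ 2 * ∫ t in (0 : ℝ)..T, ‖g t‖ ^ 2 := intervalIntegral.integral_const_mul _ _
      _ = _ := by ring

/-- If some trajectory on `[0, ∞)` with initial state `x₀` has a state tending to zero, then the
running cost can be kept bounded on all intervals `[0, N]`. -/
theorem exists_bounded_cost [FiniteDimensional ℝ X] {w₀ : ℝ → W}
    (h : (x₀, w₀) ∈ decayingTrajectories E G) :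
    ∃ c, ∀ N : ℕ, ∃ w : ℝ → W, MemLp w 2 (volume.restrict (Set.Icc 0 (N : ℝ))) ∧
      IsTrajectory E G x₀ (Set.Icc 0 (N : ℝ)) w ∧ ∫ t in (0 : ℝ)..N, ‖w t‖ ^ 2 ≤ c := by
  obtain ⟨T, hT, D, hD, H⟩ := exists_halving (E := E) (G := G)
  set S := (decayingTrajectories E G).map (LinearMap.fst ℝ X (ℝ → W)) with hS
  have key : ∀ n : ℕ, ∀ x ∈ S, ∃ w : ℝ → W, MemLp w 2 (volume.restrict (Set.Icc 0 (n * T))) ∧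
      IsTrajectory E G x (Set.Icc 0 (n * T)) w ∧
      ∫ t in (0 : ℝ)..(n * T), ‖w t‖ ^ 2 ≤ 2 * D * ‖x‖ ^ 2 := by
    intro n
    induction n with
    | zero =>
      intro x hx
      obtain ⟨w, hw, -⟩ := H x hx
      refine ⟨w, hw.1 _, hw.2.1.mono Set.Icc_subset_Ici_self, ?_⟩
      simp only [Nat.cast_zero, zero_mul, intervalIntegral.integral_same]
      positivity
    | succ n ih =>
      intro x hx
      obtain ⟨w, hw, hhalf, hcost⟩ := H x hx
      obtain ⟨w', hm', ht', hc'⟩ := ih (trajState G x w T)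
        ⟨_, decayingTrajectories_shift hw hT.le, rfl⟩
      obtain ⟨v, hv, hvt, hvc⟩ := exists_concat hT.le (by positivity) (hw.1 T) hm'
        (hw.2.1.mono Set.Icc_subset_Ici_self) ht'
      rw [show T + n * T = ((n + 1 : ℕ) : ℝ) * T by push_cast; ring] at hv hvt hvc
      refine ⟨v, hv, hvt, ?_⟩
      rw [hvc]
      have hsq : ‖trajState G x w T‖ ^ 2 ≤ (‖x‖ / 2) ^ 2 :=
        pow_le_pow_left₀ (norm_nonneg _) hhalf 2
      -- The first stretch costs `D ‖x‖²` and the rest at most `2D (‖x‖/2)²`, in total `(3/2) D ‖x‖²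
      -- ≤ 2D ‖x‖²`.
      nlinarith [mul_le_mul_of_nonneg_left hsq hD, mul_nonneg hD (sq_nonneg ‖x‖)]
  refine ⟨2 * D * ‖x₀‖ ^ 2, fun N => ?_⟩
  obtain ⟨n, hn⟩ := exists_nat_ge ((N : ℝ) / T)
  rw [div_le_iff₀ hT] at hn
  obtain ⟨w, hm, ht, hc⟩ := key n x₀ ⟨_, h, rfl⟩
  refine ⟨w, MemLp.mono_Icc hm le_rfl hn, ht.mono (Set.Icc_subset_Icc le_rfl hn), le_trans ?_ hc⟩
  have hN : (0 : ℝ) ≤ N := Nat.cast_nonneg N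
  exact intervalIntegral.integral_mono_interval le_rfl hN hn
    (Eventually.of_forall fun _ => by positivity)
    (MemLp.intervalIntegrable_norm_sq hm ⟨le_rfl, hN.trans hn⟩ ⟨hN.trans hn, le_rfl⟩)

end Decay

/-! ### Weighted norms -/

open scoped MatrixOrder in
theorem exists_isUnit_transpose_mul_self {m : ℕ} {Q : Matrix (Fin m) (Fin m) ℝ} (hQ : Q.PosDef) :
    ∃ B : Matrix (Fin m) (Fin m) ℝ, IsUnit B ∧ Q = Bᵀ * B := by
  obtain ⟨B, hB⟩ := CStarAlgebra.nonneg_iff_eq_star_mul_self.mp hQ.posSemidef.nonneg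
  rw [star_eq_conjTranspose, conjTranspose_eq_transpose_of_trivial] at hB
  refine ⟨B, ?_, hB⟩
  have h := (Matrix.isUnit_iff_isUnit_det _).1 hQ.isUnit
  rw [hB, det_mul] at h
  exact (Matrix.isUnit_iff_isUnit_det _).2 (isUnit_of_mul_isUnit_right h)

theorem transpose_mulVec_dotProduct {a b : ℕ} (M : Matrix (Fin a) (Fin b) ℝ) (v : Fin a → ℝ)
    (w : Fin b → ℝ) : (Mᵀ *ᵥ v) ⬝ᵥ w = v ⬝ᵥ (M *ᵥ w) := by
  rw [mulVec_transpose, dotProduct_mulVec]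

/-- Coordinates in which the quadratic forms of `Q⁻¹` and `Q` are squared Euclidean norms, and
which are dual to each other. -/
theorem exists_weight_equiv {m : ℕ} {Q : Matrix (Fin m) (Fin m) ℝ} (hQ : Q.PosDef) :
    ∃ (Φ : (Fin m → ℝ) ≃L[ℝ] EuclideanSpace ℝ (Fin m))
      (Ψ : (Fin m → ℝ) →L[ℝ] EuclideanSpace ℝ (Fin m)),
      (∀ q, ‖Φ q‖ ^ 2 = q ⬝ᵥ (Q⁻¹ *ᵥ q)) ∧ (∀ f, ‖Ψ f‖ ^ 2 = f ⬝ᵥ (Q *ᵥ f)) ∧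
      ∀ q f, inner ℝ (Φ q) (Ψ f) = q ⬝ᵥ f := by
  obtain ⟨B, hB, rfl⟩ := exists_isUnit_transpose_mul_self hQ
  have hdet : IsUnit B.det := (Matrix.isUnit_iff_isUnit_det _).1 hB
  have hdetT : IsUnit Bᵀ.det := by rwa [det_transpose]
  let _ : Invertible (Bᵀ)⁻¹ := (Matrix.isUnit_nonsing_inv_iff.2
    ((Matrix.isUnit_iff_isUnit_det _).2 hdetT)).invertible
  have hinner : ∀ x y : Fin m → ℝ,
      inner ℝ ((WithLp.linearEquiv 2 ℝ (Fin m → ℝ)).symm x)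
        ((WithLp.linearEquiv 2 ℝ (Fin m → ℝ)).symm y) = x ⬝ᵥ y := by
    intro x y
    rw [EuclideanSpace.inner_eq_star_dotProduct]
    simp [dotProduct_comm]
  -- With `Q = BᵀB` take `Φ = (Bᵀ)⁻¹` and `Ψ = B`: since `Q⁻¹ = B⁻¹(Bᵀ)⁻¹`, the norms are the
  -- required ones, and `B` cancels in the pairing.
  refine ⟨((Matrix.toLinearEquiv' (Bᵀ)⁻¹ inferInstance).trans
      (WithLp.linearEquiv 2 ℝ (Fin m → ℝ)).symm).toContinuousLinearEquiv,
    LinearMap.toContinuousLinearMap ((WithLp.linearEquiv 2 ℝ (Fin m → ℝ)).symm.toLinearMap ∘ₗ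
      Matrix.toLin' B), fun q => ?_, fun f => ?_, fun q f => ?_⟩
  · rw [← real_inner_self_eq_norm_sq]
    refine (hinner ((Bᵀ)⁻¹ *ᵥ q) ((Bᵀ)⁻¹ *ᵥ q)).trans ?_
    rw [Matrix.mul_inv_rev, ← mulVec_mulVec, dotProduct_mulVec q, ← mulVec_transpose,
      transpose_nonsing_inv]
  · rw [← real_inner_self_eq_norm_sq]
    refine (hinner (B *ᵥ f) (B *ᵥ f)).trans ?_
    rw [← mulVec_mulVec, ← transpose_mulVec_dotProduct Bᵀ, transpose_transpose]
  · refine (hinner ((Bᵀ)⁻¹ *ᵥ q) (B *ᵥ f)).trans ?_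
    rw [← transpose_mulVec_dotProduct, mulVec_mulVec, Matrix.mul_nonsing_inv _ hdetT, one_mulVec]

/-- The Euclidean space in which the running cost is measured. -/
abbrev CostSpace (m p : ℕ) : Type :=
  WithLp 2 (EuclideanSpace ℝ (Fin m) × EuclideanSpace ℝ (Fin p))

theorem exists_weight_equiv_prod {m p : ℕ} {Q : Matrix (Fin m) (Fin m) ℝ}
    {R : Matrix (Fin p) (Fin p) ℝ} (hQ : Q.PosDef) (hR : R.PosDef) :
    ∃ (Φ : ((Fin m → ℝ) × (Fin p → ℝ)) ≃L[ℝ] CostSpace m p)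
      (Ψ : ((Fin m → ℝ) × (Fin p → ℝ)) →L[ℝ] CostSpace m p),
      (∀ q u, ‖Φ (q, u)‖ ^ 2 = q ⬝ᵥ (Q⁻¹ *ᵥ q) + u ⬝ᵥ (R⁻¹ *ᵥ u)) ∧
      (∀ f η, ‖Ψ (f, η)‖ ^ 2 = f ⬝ᵥ (Q *ᵥ f) + η ⬝ᵥ (R *ᵥ η)) ∧
      ∀ q u f η, inner ℝ (Φ (q, u)) (Ψ (f, η)) = q ⬝ᵥ f + u ⬝ᵥ η := by
  obtain ⟨Φ₁, Ψ₁, h1, h2, h3⟩ := exists_weight_equiv hQ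
  obtain ⟨Φ₂, Ψ₂, k1, k2, k3⟩ := exists_weight_equiv hR
  refine ⟨(Φ₁.prodCongr Φ₂).trans (WithLp.prodContinuousLinearEquiv 2 ℝ _ _).symm,
    (WithLp.prodContinuousLinearEquiv 2 ℝ _ _).symm.toContinuousLinearMap.comp (Ψ₁.prodMap Ψ₂),
    fun q u => ?_, fun f η => ?_, fun q u f η => ?_⟩
  · rw [WithLp.prod_norm_sq_eq_of_L2, ← h1, ← k1]; rfl
  · rw [WithLp.prod_norm_sq_eq_of_L2, ← h2, ← k2]; rfl
  · rw [WithLp.prod_inner_apply, ← h3, ← k3]; rfl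

/-! ### The terminal cost -/

section Terminal

variable {m n : ℕ} (F : Matrix (Fin m) (Fin n) ℝ) {Q₀ : Matrix (Fin m) (Fin m) ℝ}

theorem transpose_mul_kerProj : Fᵀ * kerProj F = 0 := by
  rw [kerProj, Matrix.mul_sub, Matrix.mul_one, ← Matrix.mul_assoc, (pinv_spec Fᵀ).mul_mul_self,
    sub_self]

theorem kerProj_transpose : (kerProj F)ᵀ = kerProj F := by
  rw [kerProj, transpose_sub, transpose_one, (pinv_spec Fᵀ).right_symm]

theorem kerProj_mulVec_of_transpose_mulVec_eq_zero {k : Fin m → ℝ} (hk : Fᵀ *ᵥ k = 0) :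
    kerProj F *ᵥ k = k := by
  rw [kerProj, sub_mulVec, one_mulVec, ← mulVec_mulVec, hk, mulVec_zero, sub_zero]

/-- The normal equation behind `Mopt`: every vector in the range of `pinv Fᵀ - Mopt F Q₀` is
`Q₀⁻¹`-orthogonal to `ker Fᵀ`. With `S = P Q₀⁻¹ P`, the defect is governed by `Y = (1 - S S⁺) P`.
Since `Y Q₀⁻¹ Yᵀ = (1 - S S⁺) S (1 - S S⁺)ᵀ = 0`, definiteness of `Q₀⁻¹` forces `Y = 0`. -/
theorem kerProj_mul_inv_mul_Mopt (hQ₀ : Q₀.PosDef) :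
    kerProj F * Q₀⁻¹ * (pinv Fᵀ - Mopt F Q₀) = 0 := by
  set P := kerProj F with hP
  set S := P * Q₀⁻¹ * P with hS
  have hPT : Pᵀ = P := kerProj_transpose F
  set Y := (1 - S * pinv S) * P with hY
  have hY0 : Y * Q₀⁻¹ * Yᵀ = 0 := by
    have h1 : (1 - S * pinv S) * S = 0 := by
      rw [Matrix.sub_mul, Matrix.one_mul, (pinv_spec S).mul_mul_self, sub_self]
    calc Y * Q₀⁻¹ * Yᵀ = (1 - S * pinv S) * S * (1 - S * pinv S)ᵀ := by
          rw [hY, transpose_mul, hPT, hS]; simp only [Matrix.mul_assoc]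
      _ = 0 := by rw [h1, Matrix.zero_mul]
  have hYz : Y = 0 := by
    have hv : ∀ v, Yᵀ *ᵥ v = 0 := by
      intro v
      by_contra hne
      have hpos := hQ₀.inv.dotProduct_mulVec_pos hne
      rw [star_trivial, transpose_mulVec_dotProduct, mulVec_mulVec, mulVec_mulVec,
        hY0, zero_mulVec, dotProduct_zero] at hpos
      exact lt_irrefl _ hpos
    have : Yᵀ = 0 := by
      ext i j
      have := congrFun (hv (Pi.single j 1)) i
      simpa using this
    simpa using congrArg transpose this
  have : P * Q₀⁻¹ * (pinv Fᵀ - Mopt F Q₀) = Y * Q₀⁻¹ * pinv Fᵀ := by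
    rw [Mopt, ← hP, ← hS, hY]
    calc P * Q₀⁻¹ * (pinv Fᵀ - P * pinv S * P * Q₀⁻¹ * pinv Fᵀ)
        = P * Q₀⁻¹ * pinv Fᵀ - (P * Q₀⁻¹ * P) * pinv S * P * Q₀⁻¹ * pinv Fᵀ := by
          rw [Matrix.mul_sub]; simp only [Matrix.mul_assoc]
      _ = _ := by
          rw [← hS]; simp only [Matrix.sub_mul, Matrix.one_mul]
  rw [this, hYz, Matrix.zero_mul, Matrix.zero_mul]

/-- Among the vectors with the same image under `Fᵀ` as `q`, the one which minimizes the quadratic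
form of `Q₀⁻¹`. -/
noncomputable def terminalVec (Q₀ : Matrix (Fin m) (Fin m) ℝ) (q : Fin m → ℝ) : Fin m → ℝ :=
  (pinv Fᵀ - Mopt F Q₀) *ᵥ (Fᵀ *ᵥ q)

theorem transpose_mulVec_terminalVec (q : Fin m → ℝ) :
    Fᵀ *ᵥ terminalVec F Q₀ q = Fᵀ *ᵥ q := by
  have h : Fᵀ * Mopt F Q₀ = 0 := by
    rw [Mopt]
    simp only [← Matrix.mul_assoc]
    simp only [transpose_mul_kerProj, Matrix.zero_mul]
  rw [terminalVec, mulVec_mulVec, mulVec_mulVec, Matrix.mul_sub, h, sub_zero,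
    (pinv_spec Fᵀ).mul_mul_self]

theorem dotProduct_Qbar_mulVec (q : Fin m → ℝ) :
    q ⬝ᵥ (Qbar F Q₀ *ᵥ q) = terminalVec F Q₀ q ⬝ᵥ (Q₀⁻¹ *ᵥ terminalVec F Q₀ q) := by
  rw [terminalVec, mulVec_mulVec, ← transpose_transpose ((pinv Fᵀ - Mopt F Q₀) * Fᵀ),
    transpose_mulVec_dotProduct, Qbar, transpose_transpose, transpose_mul, transpose_transpose]
  simp only [mulVec_mulVec, Matrix.mul_assoc]

/-- Pythagoras: `b` differs from `terminalVec` by an element of `ker Fᵀ`, which is `Q₀⁻¹`-orthogonal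
to it. -/
theorem terminalVec_le (hQ₀ : Q₀.PosDef) {q b : Fin m → ℝ} (h : Fᵀ *ᵥ b = Fᵀ *ᵥ q) :
    q ⬝ᵥ (Qbar F Q₀ *ᵥ q) ≤ b ⬝ᵥ (Q₀⁻¹ *ᵥ b) := by
  rw [dotProduct_Qbar_mulVec]
  set a := terminalVec F Q₀ q with ha
  set k := b - a with hk
  have hFk : Fᵀ *ᵥ k = 0 := by
    rw [hk, mulVec_sub, h, ha, transpose_mulVec_terminalVec, sub_self]
  have hQT : (Q₀⁻¹)ᵀ = Q₀⁻¹ := by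
    simpa [conjTranspose_eq_transpose_of_trivial] using hQ₀.inv.isHermitian.eq
  have hka : k ⬝ᵥ (Q₀⁻¹ *ᵥ a) = 0 := by
    rw [← kerProj_mulVec_of_transpose_mulVec_eq_zero F hFk, ← kerProj_transpose F,
      transpose_mulVec_dotProduct, ha, terminalVec, mulVec_mulVec, mulVec_mulVec, mulVec_mulVec,
      kerProj_mul_inv_mul_Mopt F hQ₀, Matrix.zero_mul,
      zero_mulVec, dotProduct_zero]
  have hak : a ⬝ᵥ (Q₀⁻¹ *ᵥ k) = 0 := by
    rw [← transpose_mulVec_dotProduct, hQT, dotProduct_comm, hka]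
  have hkk : 0 ≤ k ⬝ᵥ (Q₀⁻¹ *ᵥ k) := by
    simpa using hQ₀.inv.posSemidef.dotProduct_mulVec_nonneg k
  have hb : b = a + k := by rw [hk]; abel
  rw [hb, mulVec_add, add_dotProduct, dotProduct_add, dotProduct_add, hka, hak]
  linarith

theorem dotProduct_Qbar_mulVec_nonneg (hQ₀ : Q₀.PosDef) (q : Fin m → ℝ) :
    0 ≤ q ⬝ᵥ (Qbar F Q₀ *ᵥ q) := by
  rw [dotProduct_Qbar_mulVec]
  simpa using hQ₀.inv.posSemidef.dotProduct_mulVec_nonneg (terminalVec F Q₀ q)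

/-- The form of `Qbar` depends on `q` only through `Fᵀ q`, so `q` itself need not converge. -/
theorem tendsto_dotProduct_Qbar_mulVec {q : ℝ → Fin m → ℝ}
    (h : Tendsto (fun t => Fᵀ *ᵥ q t) atTop (𝓝 0)) :
    Tendsto (fun t => q t ⬝ᵥ (Qbar F Q₀ *ᵥ q t)) atTop (𝓝 0) := by
  simp only [dotProduct_Qbar_mulVec, terminalVec]
  have hc : Continuous fun v : Fin n → ℝ => ((pinv Fᵀ - Mopt F Q₀) *ᵥ v) ⬝ᵥ
      (Q₀⁻¹ *ᵥ ((pinv Fᵀ - Mopt F Q₀) *ᵥ v)) := by fun_prop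
  have := (hc.tendsto 0).comp h
  rwa [mulVec_zero, mulVec_zero, dotProduct_zero] at this

end Terminal

/-! ### Dual solutions as trajectories -/

section Dual

variable {m n p : ℕ}

/-- The map `(q, u) ↦ Fᵀ q`. -/
noncomputable def dualOutput (p : ℕ) (F : Matrix (Fin m) (Fin n) ℝ) :
    ((Fin m → ℝ) × (Fin p → ℝ)) →L[ℝ] (Fin n → ℝ) :=
  (LinearMap.toContinuousLinearMap Fᵀ.mulVecLin).comp (ContinuousLinearMap.fst ℝ _ _)

/-- The map `(q, u) ↦ Aᵀ q - Hᵀ u`. -/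
noncomputable def dualDrift (A : Matrix (Fin m) (Fin n) ℝ) (H : Matrix (Fin p) (Fin n) ℝ) :
    ((Fin m → ℝ) × (Fin p → ℝ)) →L[ℝ] (Fin n → ℝ) :=
  (LinearMap.toContinuousLinearMap Aᵀ.mulVecLin).comp (ContinuousLinearMap.fst ℝ _ _)
    - (LinearMap.toContinuousLinearMap Hᵀ.mulVecLin).comp (ContinuousLinearMap.snd ℝ _ _)

@[simp]
theorem dualOutput_apply (F : Matrix (Fin m) (Fin n) ℝ) (z : (Fin m → ℝ) × (Fin p → ℝ)) :
    dualOutput p F z = Fᵀ *ᵥ z.1 := rfl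

@[simp]
theorem dualDrift_apply (A : Matrix (Fin m) (Fin n) ℝ) (H : Matrix (Fin p) (Fin n) ℝ)
    (z : (Fin m → ℝ) × (Fin p → ℝ)) : dualDrift A H z = Aᵀ *ᵥ z.1 - Hᵀ *ᵥ z.2 := rfl

variable {F A : Matrix (Fin m) (Fin n) ℝ} {H : Matrix (Fin p) (Fin n) ℝ} {ℓ : Fin m → ℝ}
  {I : Set ℝ}

theorem MemLp.prodMk {α V V' : Type*} [MeasurableSpace α] {μ : Measure α} [NormedAddCommGroup V]
    [NormedAddCommGroup V'] {q : α → V} {u : α → V'} (hq : MemLp q 2 μ) (hu : MemLp u 2 μ) :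
    MemLp (fun t => (q t, u t)) 2 μ := by
  refine (hq.norm.add hu.norm).mono' (hq.1.prodMk hu.1) (Eventually.of_forall fun t => ?_)
  rw [Prod.norm_def]
  exact max_le_add_of_nonneg (norm_nonneg _) (norm_nonneg _)

theorem IsDualSolution.memLp (Φ : ((Fin m → ℝ) × (Fin p → ℝ)) ≃L[ℝ] CostSpace m p)
    {q : ℝ → Fin m → ℝ} {u : ℝ → Fin p → ℝ} (h : IsDualSolution F A H ℓ I q u) {a b : ℝ}
    (hI : Set.Icc a b ⊆ I) :
    MemLp (fun t => Φ (q t, u t)) 2 (volume.restrict (Set.Icc a b)) :=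
  Φ.toContinuousLinearMap.comp_memLp' (MemLp.prodMk (h.memLp_q a b hI) (h.memLp_u a b hI))

theorem IsDualSolution.trajState_eq (Φ : ((Fin m → ℝ) × (Fin p → ℝ)) ≃L[ℝ] CostSpace m p)
    {q : ℝ → Fin m → ℝ} {u : ℝ → Fin p → ℝ} (h : IsDualSolution F A H ℓ I q u) {t : ℝ}
    (ht : t ∈ I) :
    trajState ((dualDrift A H).comp Φ.symm.toContinuousLinearMap) (Fᵀ *ᵥ ℓ)
      (fun t => Φ (q t, u t)) t = Fᵀ *ᵥ q t := by
  rw [h.state_eq t ht, h.initial, trajState]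
  simp

theorem IsDualSolution.isTrajectory (Φ : ((Fin m → ℝ) × (Fin p → ℝ)) ≃L[ℝ] CostSpace m p)
    (hI : MeasurableSet I) {q : ℝ → Fin m → ℝ} {u : ℝ → Fin p → ℝ}
    (h : IsDualSolution F A H ℓ I q u) :
    IsTrajectory ((dualOutput p F).comp Φ.symm.toContinuousLinearMap)
      ((dualDrift A H).comp Φ.symm.toContinuousLinearMap) (Fᵀ *ᵥ ℓ) I
      (fun t => Φ (q t, u t)) := by
  refine (ae_restrict_iff' hI).2 (Eventually.of_forall fun t ht => ?_)
  rw [h.trajState_eq Φ ht]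
  simp

/-- A locally square integrable trajectory agrees almost everywhere with a dual solution. -/
theorem exists_isDualSolution (Φ : ((Fin m → ℝ) × (Fin p → ℝ)) ≃L[ℝ] CostSpace m p)
    (hI : MeasurableSet I) (hIc : I.OrdConnected) (hI0 : I ⊆ Set.Ici 0) (h0 : (0 : ℝ) ∈ I)
    {b₀ : ℝ} (hb₀ : b₀ ∈ I) (hb₀' : 0 < b₀) {w : ℝ → CostSpace m p}
    (hm : ∀ a b : ℝ, Set.Icc a b ⊆ I → MemLp w 2 (volume.restrict (Set.Icc a b)))
    (hw : IsTrajectory ((dualOutput p F).comp Φ.symm.toContinuousLinearMap)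
      ((dualDrift A H).comp Φ.symm.toContinuousLinearMap) (Fᵀ *ᵥ ℓ) I w) :
    ∃ q : ℝ → Fin m → ℝ, IsDualSolution F A H ℓ I q (fun t => (Φ.symm (w t)).2) ∧
      (∀ᵐ t ∂(volume.restrict I), Φ (q t, (Φ.symm (w t)).2) = w t) ∧
      ∀ t ∈ I, Fᵀ *ᵥ q t
        = trajState ((dualDrift A H).comp Φ.symm.toContinuousLinearMap) (Fᵀ *ᵥ ℓ) w t := by
  classical
  set G := (dualDrift A H).comp Φ.symm.toContinuousLinearMap with hG
  set x := trajState G (Fᵀ *ᵥ ℓ) w with hx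
  have hInt : ∀ t ∈ I, IntervalIntegrable (fun s => G (w s)) volume 0 t := fun t ht =>
    intervalIntegrable_clm_comp G (MemLp.intervalIntegrable_of_Icc
      (hm 0 t (hIc.out h0 ht)) ⟨le_rfl, hI0 ht⟩ ⟨hI0 ht, le_rfl⟩)
  have hxac : ∀ a ∈ I, ∀ b ∈ I, AbsolutelyContinuousOnInterval x a b := fun a ha b hb =>
    absolutelyContinuousOnInterval_primitive (Fᵀ *ᵥ ℓ) (hInt a ha) (hInt b hb)
  have hrange : ∀ t ∈ I, Fᵀ *ᵥ (pinv Fᵀ *ᵥ x t) = x t := by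
    intro t ht
    have hbI : max t b₀ ∈ I := by rcases max_choice t b₀ with h | h <;> rw [h] <;> assumption
    have hb0 : 0 < max t b₀ := lt_max_of_lt_right hb₀'
    have hxc : ContinuousOn x (Set.Icc 0 (max t b₀)) := by
      have := (hxac 0 h0 _ hbI).continuousOn
      rwa [Set.uIcc_of_le hb0.le] at this
    have hlin : Continuous fun v : Fin n → ℝ => Fᵀ *ᵥ (pinv Fᵀ *ᵥ v) := by fun_prop
    refine Measure.eqOn_Icc_of_ae_eq volume hb0.ne ?_ (hlin.comp_continuousOn hxc) hxc
      (x := t) ⟨hI0 ht, le_max_left _ _⟩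
    filter_upwards [hw.mono (hIc.out h0 hbI)] with s hs
    have hs' : Fᵀ *ᵥ (Φ.symm (w s)).1 = x s := hs
    rw [Function.comp_apply, ← hs', mulVec_mulVec, mulVec_mulVec,
      (pinv_spec Fᵀ).mul_mul_self]
  -- A dual solution must satisfy its equation at every time, so `q` is corrected on the exceptional
  -- null set by a preimage of the state under `Fᵀ`.
  set q : ℝ → Fin m → ℝ := fun t =>
    if Fᵀ *ᵥ (Φ.symm (w t)).1 = x t then (Φ.symm (w t)).1 else pinv Fᵀ *ᵥ x t with hq
  have hFq : ∀ t ∈ I, Fᵀ *ᵥ q t = x t := by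
    intro t ht
    by_cases h : Fᵀ *ᵥ (Φ.symm (w t)).1 = x t
    · simp only [hq, if_pos h]; exact h
    · simp only [hq, if_neg h]; exact hrange t ht
  have hqae : ∀ᵐ t ∂(volume.restrict I), q t = (Φ.symm (w t)).1 := by
    filter_upwards [hw] with t ht
    have ht' : Fᵀ *ᵥ (Φ.symm (w t)).1 = x t := ht
    simp only [hq, if_pos ht']
  have hx0 : x 0 = Fᵀ *ᵥ ℓ := by simp [hx, trajState]
  refine ⟨q, ⟨fun a b hab => ?_, fun a b hab => ?_, fun a b hle hab => ?_, fun t ht => ?_, ?_⟩,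
    ?_, hFq⟩
  · have hqab : q =ᵐ[volume.restrict (Set.Icc a b)] fun t => (Φ.symm (w t)).1 :=
      ae_mono (Measure.restrict_mono hab le_rfl) hqae
    refine MemLp.ae_eq hqab.symm ?_
    exact ((ContinuousLinearMap.fst ℝ _ _).comp Φ.symm.toContinuousLinearMap).comp_memLp'
      (hm a b hab)
  · exact ((ContinuousLinearMap.snd ℝ _ _).comp Φ.symm.toContinuousLinearMap).comp_memLp'
      (hm a b hab)
  · refine absolutelyContinuousOnInterval_congr
      (hxac a (hab ⟨le_rfl, hle⟩) b (hab ⟨hle, le_rfl⟩)) fun t ht => ?_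
    rw [Set.uIcc_of_le hle] at ht
    exact (hFq t (hab ht)).symm
  · rw [hFq t ht, hFq 0 h0, hx0, hx, trajState]
    congr 1
    refine intervalIntegral.integral_congr_ae ?_
    rw [Set.uIoc_of_le (hI0 ht)]
    filter_upwards [(ae_restrict_iff' hI).1 hqae] with s hs hst
    rw [hs (hIc.out h0 ht ⟨hst.1.le, hst.2⟩)]
    simp [hG]
  · rw [hFq 0 h0, hx0]
  · filter_upwards [hqae] with t ht
    rw [ht]
    simp

theorem dualCost_eq {Q₀ Q : Matrix (Fin m) (Fin m) ℝ} {R : Matrix (Fin p) (Fin p) ℝ}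
    {Φ : ((Fin m → ℝ) × (Fin p → ℝ)) ≃L[ℝ] CostSpace m p}
    (hΦ : ∀ q u, ‖Φ (q, u)‖ ^ 2 = q ⬝ᵥ (Q⁻¹ *ᵥ q) + u ⬝ᵥ (R⁻¹ *ᵥ u))
    (q : ℝ → Fin m → ℝ) (u : ℝ → Fin p → ℝ) (τ : ℝ) :
    dualCost F Q₀ Q R q u τ
      = q τ ⬝ᵥ (Qbar F Q₀ *ᵥ q τ) + ∫ t in (0 : ℝ)..τ, ‖Φ (q t, u t)‖ ^ 2 := by
  simp only [dualCost, rho, hΦ]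

theorem IsDualSolution.mono {q : ℝ → Fin m → ℝ} {u : ℝ → Fin p → ℝ} {J : Set ℝ}
    (h : IsDualSolution F A H ℓ I q u) (hJ : J ⊆ I) : IsDualSolution F A H ℓ J q u :=
  ⟨fun a b hab => h.memLp_q a b (hab.trans hJ), fun a b hab => h.memLp_u a b (hab.trans hJ),
    fun a b hle hab => h.absCont a b hle (hab.trans hJ), fun t ht => h.state_eq t (hJ ht),
    h.initial⟩

end Dual

/-! ### Square integrable functions on `[0, τ]` -/

section Tools

theorem measurePreserving_reflect (τ : ℝ) :
    MeasurePreserving (fun t => τ - t) (volume.restrict (Set.Icc 0 τ))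
      (volume.restrict (Set.Icc 0 τ)) := by
  have h := (Measure.measurePreserving_sub_left (volume : Measure ℝ) τ).restrict_preimage
    (measurableSet_Icc (a := 0) (b := τ))
  rwa [Set.preimage_const_sub_Icc, sub_self, sub_zero] at h

theorem Continuous.memLp_Icc {V : Type*} [NormedAddCommGroup V] [SecondCountableTopology V]
    {f : ℝ → V} (hf : Continuous f) (a b : ℝ) :
    MemLp f 2 (volume.restrict (Set.Icc a b)) := by
  borelize V
  obtain ⟨C, hC⟩ := (isCompact_Icc (a := a) (b := b)).exists_bound_of_continuousOn hf.continuousOn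
  exact MemLp.of_bound hf.aestronglyMeasurable C
    ((ae_restrict_iff' measurableSet_Icc).2 (Eventually.of_forall hC))

theorem MemLp.mulVec {a b : ℕ} (M : Matrix (Fin a) (Fin b) ℝ) {f : ℝ → Fin b → ℝ} {μ : Measure ℝ}
    (hf : MemLp f 2 μ) : MemLp (fun t => M *ᵥ f t) 2 μ :=
  (LinearMap.toContinuousLinearMap M.mulVecLin).comp_memLp' hf

theorem MemLp.integrable_dotProduct {k : ℕ} {f g : ℝ → Fin k → ℝ} {μ : Measure ℝ}
    (hf : MemLp f 2 μ) (hg : MemLp g 2 μ) : Integrable (fun t => f t ⬝ᵥ g t) μ := by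
  refine integrable_finsetSum _ fun i _ => ?_
  exact ((memLp_pi_iff.1 hf i).integrable_mul (memLp_pi_iff.1 hg i))

theorem MemLp.intervalIntegrable_dotProduct {k : ℕ} {f g : ℝ → Fin k → ℝ} {τ : ℝ} (hτ : 0 ≤ τ)
    (hf : MemLp f 2 (volume.restrict (Set.Icc 0 τ)))
    (hg : MemLp g 2 (volume.restrict (Set.Icc 0 τ))) :
    IntervalIntegrable (fun t => f t ⬝ᵥ g t) volume 0 τ := by
  have h : IntegrableOn (fun t => f t ⬝ᵥ g t) (Set.Icc 0 τ) := MemLp.integrable_dotProduct hf hg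
  exact (h.mono_set (by rw [Set.uIcc_of_le hτ])).intervalIntegrable

theorem mulVec_intervalIntegral {a b : ℕ} (M : Matrix (Fin a) (Fin b) ℝ) {f : ℝ → Fin b → ℝ}
    {s t : ℝ} (hf : IntervalIntegrable f volume s t) :
    M *ᵥ (∫ r in s..t, f r) = ∫ r in s..t, M *ᵥ f r :=
  ((LinearMap.toContinuousLinearMap M.mulVecLin).intervalIntegral_comp_comm hf).symm

theorem intervalIntegrable_mulVec {a b : ℕ} (M : Matrix (Fin a) (Fin b) ℝ) {f : ℝ → Fin b → ℝ}
    {s t : ℝ} (hf : IntervalIntegrable f volume s t) :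
    IntervalIntegrable (fun r => M *ᵥ f r) volume s t :=
  intervalIntegrable_clm_comp (LinearMap.toContinuousLinearMap M.mulVecLin) hf

/-- If the primitive of `f` stays in the kernel of `M`, then so does `f`, almost everywhere. -/
theorem ae_mulVec_eq_zero {a b : ℕ} (M : Matrix (Fin a) (Fin b) ℝ) {f : ℝ → Fin b → ℝ} {τ : ℝ}
    (hτ : 0 ≤ τ) (hf : IntervalIntegrable f volume 0 τ)
    (h : ∀ t ∈ Set.Icc 0 τ, M *ᵥ (∫ s in (0 : ℝ)..t, f s) = 0) :
    ∀ᵐ t, t ∈ Set.Ioc 0 τ → M *ᵥ f t = 0 := by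
  -- The right endpoint is discarded so that the primitive is known on a neighbourhood of `t`.
  have hae : ∀ᵐ t : ℝ, t ≠ τ := by simp [ae_iff, measure_singleton]
  filter_upwards [(intervalIntegrable_mulVec M hf).ae_hasDerivAt_integral, hae] with t ht hne htm
  have hIoo : t ∈ Set.Ioo 0 τ := ⟨htm.1, lt_of_le_of_ne htm.2 hne⟩
  have hd := ht (by rw [Set.uIcc_of_le hτ]; exact Set.Ioo_subset_Icc_self hIoo) 0 Set.left_mem_uIcc
  refine hd.unique ((hasDerivAt_const t (0 : Fin a → ℝ)).congr_of_eventuallyEq ?_)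
  filter_upwards [Ioo_mem_nhds hIoo.1 hIoo.2] with s hs
  have hs' := Set.Ioo_subset_Icc_self hs
  rw [← mulVec_intervalIntegral M (hf.mono_set
    (Set.uIcc_subset_uIcc_left (by rwa [Set.uIcc_of_le hτ]))), h s hs']

theorem norm_sq_toLp_prod {E V : Type*} [NormedAddCommGroup E] [InnerProductSpace ℝ E]
    [NormedAddCommGroup V] [InnerProductSpace ℝ V] {τ : ℝ} (hτ : 0 ≤ τ) (e : E) {w : ℝ → V}
    (hw : MemLp w 2 (volume.restrict (Set.Icc 0 τ))) :
    ‖WithLp.toLp 2 (e, hw.toLp w)‖ ^ 2 = ‖e‖ ^ 2 + ∫ t in (0 : ℝ)..τ, ‖w t‖ ^ 2 := by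
  rw [WithLp.prod_norm_sq_eq_of_L2, WithLp.toLp_fst, WithLp.toLp_snd, MemLp.norm_toLp_sq,
    intervalIntegral.integral_of_le hτ, integral_Icc_eq_integral_Ioc]

theorem inner_toLp_prod {E V : Type*} [NormedAddCommGroup E] [InnerProductSpace ℝ E]
    [NormedAddCommGroup V] [InnerProductSpace ℝ V] {τ : ℝ} (hτ : 0 ≤ τ) (e e' : E) {w w' : ℝ → V}
    (hw : MemLp w 2 (volume.restrict (Set.Icc 0 τ)))
    (hw' : MemLp w' 2 (volume.restrict (Set.Icc 0 τ))) :
    inner ℝ (WithLp.toLp 2 (e, hw.toLp w)) (WithLp.toLp 2 (e', hw'.toLp w'))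
      = inner ℝ e e' + ∫ t in (0 : ℝ)..τ, inner ℝ (w t) (w' t) := by
  rw [WithLp.prod_inner_apply, L2.inner_def, intervalIntegral.integral_of_le hτ,
    ← integral_Icc_eq_integral_Ioc]
  congr 1
  refine integral_congr_ae ?_
  filter_upwards [hw.coeFn_toLp, hw'.coeFn_toLp] with t h1 h2
  simp only [h1, h2]

end Tools

/-! ### The estimation error of an observer generated by a dual solution -/

section ErrorBound

variable {m n p : ℕ} {F A : Matrix (Fin m) (Fin n) ℝ} {H : Matrix (Fin p) (Fin n) ℝ}
  {Q₀ Q : Matrix (Fin m) (Fin m) ℝ} {R : Matrix (Fin p) (Fin p) ℝ} {ℓ : Fin m → ℝ}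

theorem kerProj_mul (F : Matrix (Fin m) (Fin n) ℝ) : kerProj F * F = 0 := by
  have := congrArg transpose (transpose_mul_kerProj F)
  rwa [transpose_mul, transpose_transpose, kerProj_transpose, transpose_zero] at this

theorem mulVec_dotProduct {a b : ℕ} (M : Matrix (Fin a) (Fin b) ℝ) (v : Fin b → ℝ)
    (w : Fin a → ℝ) : (M *ᵥ v) ⬝ᵥ w = v ⬝ᵥ (Mᵀ *ᵥ w) := by
  rw [← transpose_mulVec_dotProduct, transpose_transpose]

/-- `pinv Fᵀ * Fᵀ` is the orthogonal projection complementary to `kerProj F`, so it may be dropped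
against a vector killed by `kerProj F`. -/
theorem pinv_mul_dotProduct_of_kerProj {a z : Fin m → ℝ} (ha : kerProj F *ᵥ a = 0) :
    a ⬝ᵥ (pinv Fᵀ *ᵥ (Fᵀ *ᵥ z)) = a ⬝ᵥ z := by
  have h1 : pinv Fᵀ *ᵥ (Fᵀ *ᵥ z) = z - kerProj F *ᵥ z := by
    rw [kerProj, sub_mulVec, one_mulVec, mulVec_mulVec]; abel
  rw [h1, dotProduct_sub, ← transpose_mulVec_dotProduct, kerProj_transpose, ha, zero_dotProduct,
    sub_zero]

/-- The duality formula for the estimation error. -/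
theorem estimation_error_eq {τ : ℝ} (hτ : 0 ≤ τ) {q : ℝ → Fin m → ℝ} {u : ℝ → Fin p → ℝ}
    (hd : IsDualSolution F A H ℓ (Set.Icc 0 τ) q u) {x : ℝ → Fin n → ℝ} {f : ℝ → Fin m → ℝ}
    {y η : ℝ → Fin p → ℝ} (hs : IsSolution F A H (Set.Icc 0 τ) x f y η) :
    ℓ ⬝ᵥ (F *ᵥ x τ) - estimate (fun s => u (τ - s)) y τ
      = q τ ⬝ᵥ (F *ᵥ x 0) + ∫ s in (0 : ℝ)..τ, (q (τ - s) ⬝ᵥ f s + -u (τ - s) ⬝ᵥ η s) := by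
  have h0 : (0 : ℝ) ∈ Set.Icc 0 τ := ⟨le_rfl, hτ⟩
  have h1 : τ ∈ Set.Icc 0 τ := ⟨hτ, le_rfl⟩
  have hx := hs.memLp_x 0 τ le_rfl
  have hf := hs.memLp_f 0 τ le_rfl
  have hy := hs.memLp_y 0 τ le_rfl
  have hη := hs.memLp_η 0 τ le_rfl
  set z : ℝ → Fin m → ℝ := fun s => q (τ - s) with hz
  set U : ℝ → Fin p → ℝ := fun s => u (τ - s) with hU
  have hzm : MemLp z 2 (volume.restrict (Set.Icc 0 τ)) :=
    (hd.memLp_q 0 τ le_rfl).comp_measurePreserving (measurePreserving_reflect τ)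
  have hUm : MemLp U 2 (volume.restrict (Set.Icc 0 τ)) :=
    (hd.memLp_u 0 τ le_rfl).comp_measurePreserving (measurePreserving_reflect τ)
  set a : ℝ → Fin m → ℝ := fun s => A *ᵥ x s + f s with ha
  set b : ℝ → Fin n → ℝ := fun s => Hᵀ *ᵥ U s - Aᵀ *ᵥ z s with hb
  have ham : MemLp a 2 (volume.restrict (Set.Icc 0 τ)) := (MemLp.mulVec A hx).add hf
  have hbm : MemLp b 2 (volume.restrict (Set.Icc 0 τ)) :=
    (MemLp.mulVec Hᵀ hUm).sub (MemLp.mulVec Aᵀ hzm)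
  have hai : ∀ t ∈ Set.Icc 0 τ, IntervalIntegrable a volume 0 t := fun t ht =>
    MemLp.intervalIntegrable_of_Icc ham h0 ht
  have hbi : ∀ t ∈ Set.Icc 0 τ, IntervalIntegrable b volume 0 t := fun t ht =>
    MemLp.intervalIntegrable_of_Icc hbm h0 ht
  have hα : ∀ t ∈ Set.Icc 0 τ, F *ᵥ x t = F *ᵥ x 0 + ∫ s in (0 : ℝ)..t, a s := hs.state_eq
  have hgi : ∀ t ∈ Set.Icc 0 τ,
      IntervalIntegrable (fun s => Aᵀ *ᵥ q s - Hᵀ *ᵥ u s) volume t τ := fun t ht =>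
    MemLp.intervalIntegrable_of_Icc ((MemLp.mulVec Aᵀ (hd.memLp_q 0 τ le_rfl)).sub
      (MemLp.mulVec Hᵀ (hd.memLp_u 0 τ le_rfl))) ht h1
  have hβ : ∀ t ∈ Set.Icc 0 τ, Fᵀ *ᵥ z t = Fᵀ *ᵥ z 0 + ∫ s in (0 : ℝ)..t, b s := by
    intro t ht
    have htτ : τ - t ∈ Set.Icc 0 τ := ⟨by linarith [ht.2], by linarith [ht.1]⟩
    have e1 : ∫ s in (0 : ℝ)..t, b s = -∫ s in (τ - t)..τ, (Aᵀ *ᵥ q s - Hᵀ *ᵥ u s) := by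
      have := intervalIntegral.integral_comp_sub_left (a := 0) (b := t)
        (fun s => Aᵀ *ᵥ q s - Hᵀ *ᵥ u s) τ
      rw [sub_zero] at this
      rw [← this, ← intervalIntegral.integral_neg]
      refine intervalIntegral.integral_congr fun s _ => ?_
      simp only [hb, hz, hU, neg_sub]
    simp only [hz, sub_zero]
    rw [e1, hd.state_eq _ htτ, hd.state_eq τ h1,
      ← intervalIntegral.integral_add_adjacent_intervals
        ((hgi 0 h0).trans (hgi _ htτ).symm) (hgi _ htτ)]
    abel
  -- Neither `x` nor `z` need be absolutely continuous, only `Fx` and `Fᵀz`. Their product is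
  -- therefore written as `Fx ⬝ (Fᵀ)⁺ Fᵀz`, and the pseudoinverse is removed afterwards because the
  -- derivatives `a` and `b` lie almost everywhere in the ranges of `F` and `Fᵀ`.
  have haP : ∀ᵐ t, t ∈ Set.Ioc 0 τ → kerProj F *ᵥ a t = 0 := by
    refine ae_mulVec_eq_zero _ hτ (hai τ h1) fun t ht => ?_
    have : ∫ s in (0 : ℝ)..t, a s = F *ᵥ x t - F *ᵥ x 0 := by rw [hα t ht]; abel
    rw [this, mulVec_sub, mulVec_mulVec, mulVec_mulVec, kerProj_mul, zero_mulVec, zero_mulVec,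
      sub_zero]
  have hbP : ∀ᵐ t, t ∈ Set.Ioc 0 τ → (1 - Fᵀ * pinv Fᵀ) *ᵥ b t = 0 := by
    refine ae_mulVec_eq_zero _ hτ (hbi τ h1) fun t ht => ?_
    have h2 : ∫ s in (0 : ℝ)..t, b s = Fᵀ *ᵥ z t - Fᵀ *ᵥ z 0 := by rw [hβ t ht]; abel
    have h3 : (1 - Fᵀ * pinv Fᵀ) * Fᵀ = 0 := by
      rw [Matrix.sub_mul, Matrix.one_mul, (pinv_spec Fᵀ).mul_mul_self, sub_self]
    rw [h2, mulVec_sub, mulVec_mulVec, mulVec_mulVec, h3, zero_mulVec, zero_mulVec, sub_zero]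
  have hparts := integral_dotProduct_primitive (α := fun t => F *ᵥ x t)
    (β := fun t => pinv Fᵀ *ᵥ (Fᵀ *ᵥ z t)) hτ (hai τ h1)
    (intervalIntegrable_mulVec (pinv Fᵀ) (hbi τ h1)) hα (fun t ht => by
      rw [hβ t ht, mulVec_add, mulVec_intervalIntegral _ (hbi t ht)])
  have hPF : ∀ t, kerProj F *ᵥ (F *ᵥ x t) = 0 := fun t => by
    rw [mulVec_mulVec, kerProj_mul, zero_mulVec]
  have hz0 : z τ = q 0 := by simp [hz]
  have hz1 : z 0 = q τ := by simp [hz]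
  rw [hz0, hd.initial, pinv_mul_dotProduct_of_kerProj (hPF _),
    pinv_mul_dotProduct_of_kerProj (hPF _), hz1] at hparts
  have hyae : ∀ᵐ t, t ∈ Set.Icc 0 τ → y t = H *ᵥ x t + η t :=
    (ae_restrict_iff' measurableSet_Icc).1 hs.output_eq
  have hcongr : ∫ t in (0 : ℝ)..τ, (a t ⬝ᵥ (pinv Fᵀ *ᵥ (Fᵀ *ᵥ z t))
      + (F *ᵥ x t) ⬝ᵥ (pinv Fᵀ *ᵥ b t))
      = ∫ t in (0 : ℝ)..τ, ((z t ⬝ᵥ f t + -U t ⬝ᵥ η t) + y t ⬝ᵥ U t) := by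
    refine intervalIntegral.integral_congr_ae ?_
    filter_upwards [haP, hbP, hyae] with t h2 h3 h4 ht
    rw [Set.uIoc_of_le hτ] at ht
    rw [pinv_mul_dotProduct_of_kerProj (h2 ht), h4 (Set.Ioc_subset_Icc_self ht)]
    have h5 : Fᵀ *ᵥ (pinv Fᵀ *ᵥ b t) = b t := by
      have := h3 ht
      rw [sub_mulVec, one_mulVec, sub_eq_zero] at this
      rw [mulVec_mulVec, ← this]
    rw [mulVec_dotProduct F, h5, hb, ha]
    simp only [dotProduct_sub, add_dotProduct, neg_dotProduct]
    rw [mulVec_dotProduct A, ← transpose_mulVec_dotProduct Hᵀ, transpose_transpose,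
      dotProduct_comm (f t), dotProduct_comm (η t)]
    ring
  rw [hcongr, intervalIntegral.integral_add
    ((MemLp.intervalIntegrable_dotProduct hτ hzm hf).add
      (MemLp.intervalIntegrable_dotProduct hτ (f := fun s => -U s) hUm.neg hη))
    (MemLp.intervalIntegrable_dotProduct hτ hy hUm)] at hparts
  rw [estimate, dotProduct_comm ℓ, dotProduct_comm (q τ)]
  linarith

/-- The worst-case error of the observer generated by a dual solution is at most its dual cost. -/
theorem worstCaseError_le_dualCost (hQ₀ : Q₀.PosDef) (hQ : Q.PosDef) (hR : R.PosDef) {τ : ℝ}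
    (hτ : 0 ≤ τ) {q : ℝ → Fin m → ℝ} {u : ℝ → Fin p → ℝ}
    (hd : IsDualSolution F A H ℓ (Set.Icc 0 τ) q u) :
    worstCaseError F A H Q₀ Q R ℓ (fun s => u (τ - s)) τ
      ≤ ((dualCost F Q₀ Q R q u τ : ℝ) : EReal) := by
  obtain ⟨Φ₀, Ψ₀, hΦ₀, hΨ₀, hΦΨ₀⟩ := exists_weight_equiv hQ₀
  obtain ⟨Φ, Ψ, hΦ, hΨ, hΦΨ⟩ := exists_weight_equiv_prod hQ hR
  refine iSup_le fun x => iSup_le fun f => iSup_le fun y => iSup_le fun η => iSup_le fun hs => ?_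
  rw [EReal.coe_le_coe_iff]
  have hf := hs.solution.memLp_f 0 τ le_rfl
  have hη := hs.solution.memLp_η 0 τ le_rfl
  have hzm : MemLp (fun s => q (τ - s)) 2 (volume.restrict (Set.Icc 0 τ)) :=
    (hd.memLp_q 0 τ le_rfl).comp_measurePreserving (measurePreserving_reflect τ)
  have hUm : MemLp (fun s => -u (τ - s)) 2 (volume.restrict (Set.Icc 0 τ)) :=
    ((hd.memLp_u 0 τ le_rfl).comp_measurePreserving (measurePreserving_reflect τ)).neg
  have hk : MemLp (fun s => Φ (q (τ - s), -u (τ - s))) 2 (volume.restrict (Set.Icc 0 τ)) :=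
    Φ.toContinuousLinearMap.comp_memLp' (MemLp.prodMk hzm hUm)
  have hξ : MemLp (fun s => Ψ (f s, η s)) 2 (volume.restrict (Set.Icc 0 τ)) :=
    Ψ.comp_memLp' (MemLp.prodMk hf hη)
  -- Against `F x(0)` only `Fᵀ q(τ)` matters, so `q(τ)` may be replaced by the cheapest vector with
  -- the same image, whose weight is the terminal cost.
  set a := terminalVec F Q₀ (q τ) with ha
  have hin := inner_toLp_prod hτ (Φ₀ a) (Ψ₀ (F *ᵥ x 0)) hk hξ
  simp only [hΦΨ₀, hΦΨ] at hin
  have haF : a ⬝ᵥ (F *ᵥ x 0) = q τ ⬝ᵥ (F *ᵥ x 0) := by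
    rw [← transpose_mulVec_dotProduct, ha, transpose_mulVec_terminalVec,
      transpose_mulVec_dotProduct]
  rw [haF, ← estimation_error_eq hτ hd hs.solution] at hin
  have hkn := norm_sq_toLp_prod hτ (Φ₀ a) hk
  have hξn := norm_sq_toLp_prod hτ (Ψ₀ (F *ᵥ x 0)) hξ
  simp only [hΨ₀, hΨ] at hξn
  have hρ := hs.bound τ ⟨hτ, le_rfl⟩
  rw [rho, ← hξn] at hρ
  have hcost : dualCost F Q₀ Q R q u τ
      = ‖WithLp.toLp 2 (Φ₀ a, hk.toLp (fun s => Φ (q (τ - s), -u (τ - s))))‖ ^ 2 := by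
    rw [hkn, dualCost_eq hΦ, dotProduct_Qbar_mulVec, hΦ₀]
    congr 1
    have := intervalIntegral.integral_comp_sub_left (a := 0) (b := τ)
      (fun s => ‖Φ (q s, u s)‖ ^ 2) τ
    rw [sub_self, sub_zero] at this
    rw [← this]
    refine intervalIntegral.integral_congr fun s _ => ?_
    simp only [hΦ, neg_dotProduct, mulVec_neg, dotProduct_neg, neg_neg]
  rw [hcost, ← hin]
  refine (sq_le_sq' (neg_le_of_abs_le (abs_real_inner_le_norm _ _))
    (real_inner_le_norm _ _)).trans ?_
  rw [mul_pow]
  exact mul_le_of_le_one_right (sq_nonneg _) hρ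

end ErrorBound

/-! ### Dual solutions from bounds on the estimation error -/

section Duality

variable {m n p : ℕ} {F A : Matrix (Fin m) (Fin n) ℝ} {H : Matrix (Fin p) (Fin n) ℝ}
  {Q₀ Q : Matrix (Fin m) (Fin m) ℝ} {R : Matrix (Fin p) (Fin p) ℝ} {ℓ : Fin m → ℝ}

/-- Smooth bumps times basis vectors are continuous test functions, so the fundamental lemma of the
calculus of variations applies coordinatewise. -/
theorem ae_eq_zero_of_integral_dotProduct_continuous {k : ℕ} {f : ℝ → Fin k → ℝ} {τ : ℝ}
    (hτ : 0 ≤ τ) (hf : MemLp f 2 (volume.restrict (Set.Icc 0 τ)))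
    (h : ∀ ψ : C(ℝ, Fin k → ℝ), ∫ t in (0 : ℝ)..τ, f t ⬝ᵥ ψ t = 0) :
    ∀ᵐ t ∂(volume.restrict (Set.Icc 0 τ)), f t = 0 := by
  have hfi : Integrable f (volume.restrict (Set.Icc 0 τ)) := hf.integrable one_le_two
  refine ae_eq_zero_of_integral_contDiff_smul_eq_zero hfi.locallyIntegrable fun g hg hgs => ?_
  have hgi : Integrable (fun t => g t • f t) (volume.restrict (Set.Icc 0 τ)) := by
    obtain ⟨C, hC⟩ := hgs.exists_bound_of_continuous hg.continuous
    exact hfi.bdd_smul C hg.continuous.aestronglyMeasurable (Eventually.of_forall hC)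
  funext i
  have := h ⟨fun t => g t • Pi.single i 1, hg.continuous.smul continuous_const⟩
  rw [intervalIntegral.integral_of_le hτ, ← integral_Icc_eq_integral_Ioc] at this
  rw [Pi.zero_apply, eval_integral fun i => hgi.eval i]
  refine Eq.trans ?_ this
  refine integral_congr_ae (Eventually.of_forall fun t => ?_)
  simp

/-- The pairs `(e, ψ)` parametrize the continuously differentiable functions `x` by
`x(t) = e + ∫₀ᵗ ψ`. -/
noncomputable def testState (n : ℕ) :
    ((Fin n → ℝ) × C(ℝ, Fin n → ℝ)) →ₗ[ℝ] (ℝ → Fin n → ℝ) where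
  toFun v t := v.1 + ∫ s in (0 : ℝ)..t, v.2 s
  map_add' v w := by
    funext t
    simp only [Prod.fst_add, Prod.snd_add, ContinuousMap.add_apply, Pi.add_apply]
    rw [intervalIntegral.integral_add (v.2.continuous.intervalIntegrable _ _)
      (w.2.continuous.intervalIntegrable _ _)]
    abel
  map_smul' c v := by
    funext t
    simp only [Prod.smul_fst, Prod.smul_snd, ContinuousMap.smul_apply, Pi.smul_apply,
      intervalIntegral.integral_smul, smul_add, RingHom.id_apply]

theorem testState_apply (v : (Fin n → ℝ) × C(ℝ, Fin n → ℝ)) (t : ℝ) :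
    testState n v t = v.1 + ∫ s in (0 : ℝ)..t, v.2 s := rfl

theorem testState_zero (v : (Fin n → ℝ) × C(ℝ, Fin n → ℝ)) : testState n v 0 = v.1 := by
  simp [testState_apply]

theorem continuous_testState (v : (Fin n → ℝ) × C(ℝ, Fin n → ℝ)) :
    Continuous (testState n v) :=
  continuous_const.add (intervalIntegral.continuous_primitive
    (fun a b => v.2.continuous.intervalIntegrable a b) 0)

variable (F A H) in
/-- The disturbances `(f, η)` for which `x = testState v` has zero output. -/
noncomputable def testInput :
    ((Fin n → ℝ) × C(ℝ, Fin n → ℝ)) →ₗ[ℝ] (ℝ → (Fin m → ℝ) × (Fin p → ℝ)) where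
  toFun v t := (F *ᵥ v.2 t - A *ᵥ testState n v t, -(H *ᵥ testState n v t))
  map_add' v w := by
    funext t
    simp only [map_add, Prod.snd_add, ContinuousMap.add_apply, Pi.add_apply, mulVec_add,
      Prod.mk_add_mk, neg_add]
    congr 1
    abel
  map_smul' c v := by
    funext t
    simp only [map_smul, Prod.smul_snd, ContinuousMap.smul_apply, Pi.smul_apply, mulVec_smul,
      RingHom.id_apply, Prod.smul_mk, smul_sub, smul_neg]

theorem testInput_apply (v : (Fin n → ℝ) × C(ℝ, Fin n → ℝ)) (t : ℝ) :
    testInput F A H v t = (F *ᵥ v.2 t - A *ᵥ testState n v t, -(H *ᵥ testState n v t)) := rfl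

theorem continuous_testInput (v : (Fin n → ℝ) × C(ℝ, Fin n → ℝ)) :
    Continuous (testInput F A H v) := by
  have := continuous_testState v
  have := v.2.continuous
  change Continuous fun t => (F *ᵥ v.2 t - A *ᵥ testState n v t, -(H *ᵥ testState n v t))
  fun_prop

/-- Any continuously differentiable `x` is a solution with output `y = 0`, once `f` and `η` are
chosen to make it so. These solutions are invisible to every observer. -/
theorem isSolution_testState (v : (Fin n → ℝ) × C(ℝ, Fin n → ℝ)) (τ : ℝ) :
    IsSolution F A H (Set.Icc 0 τ) (testState n v) (fun t => (testInput F A H v t).1) 0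
      (fun t => (testInput F A H v t).2) := by
  have hx := continuous_testState v
  have hψ := v.2.continuous
  have hin := continuous_testInput (F := F) (A := A) (H := H) v
  have hFx : ∀ t, F *ᵥ testState n v t = F *ᵥ v.1 + ∫ s in (0 : ℝ)..t, F *ᵥ v.2 s := fun t => by
    rw [testState_apply, mulVec_add, mulVec_intervalIntegral _ (hψ.intervalIntegrable _ _)]
  have hi : ∀ a b, IntervalIntegrable (fun s => F *ᵥ v.2 s) volume a b := fun a b =>
    intervalIntegrable_mulVec F (hψ.intervalIntegrable _ _)
  refine ⟨fun a b _ => Continuous.memLp_Icc hx a b, fun a b _ => Continuous.memLp_Icc hin.fst a b,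
    fun a b _ => MemLp.zero, fun a b _ => Continuous.memLp_Icc hin.snd a b, fun a b _ _ => ?_,
    fun t _ => ?_, Eventually.of_forall fun t => ?_⟩
  · simp only [hFx]
    exact absolutelyContinuousOnInterval_primitive _ (hi _ _) (hi _ _)
  · rw [hFx t, testState_zero]
    simp [testInput_apply]
  · simp [testInput_apply]

/-- If some estimate has worst-case error at most `c` on `[0, τ]`, then there is a dual solution
with dual cost at most `c`. -/
theorem exists_dualCost_le (hQ₀ : Q₀.PosDef) (hQ : Q.PosDef) (hR : R.PosDef) {τ : ℝ}
    (hτ : 0 < τ) {U : ℝ → Fin p → ℝ} {c : ℝ}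
    (hc : worstCaseError F A H Q₀ Q R ℓ U τ ≤ (c : EReal)) :
    ∃ (q : ℝ → Fin m → ℝ) (u : ℝ → Fin p → ℝ), IsDualSolution F A H ℓ (Set.Icc 0 τ) q u ∧
      dualCost F Q₀ Q R q u τ ≤ c := by
  obtain ⟨Φ₀, Ψ₀, hΦ₀, hΨ₀, hΦΨ₀⟩ := exists_weight_equiv hQ₀
  obtain ⟨Φ, Ψ, hΦ, hΨ, hΦΨ⟩ := exists_weight_equiv_prod hQ hR
  have h0 : (0 : ℝ) ∈ Set.Icc 0 τ := ⟨le_rfl, hτ.le⟩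
  have h1 : τ ∈ Set.Icc 0 τ := ⟨hτ.le, le_rfl⟩
  have hmΨ : ∀ v, MemLp (fun t => Ψ (testInput F A H v t)) 2 (volume.restrict (Set.Icc 0 τ)) :=
    fun v => Continuous.memLp_Icc (Ψ.continuous.comp (continuous_testInput v)) 0 τ
  -- `T` records the weighted disturbances of a test solution, so `‖T v‖²` is its `rho` at time `τ`;
  -- `L` is the quantity to be estimated.
  let T : ((Fin n → ℝ) × C(ℝ, Fin n → ℝ)) →ₗ[ℝ] WithLp 2 (EuclideanSpace ℝ (Fin m) ×
      Lp (CostSpace m p) 2 (volume.restrict (Set.Icc 0 τ))) :=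
    { toFun := fun v => WithLp.toLp 2 (Ψ₀ (F *ᵥ v.1), (hmΨ v).toLp _)
      map_add' := fun v w => by
        have e : (hmΨ (v + w)).toLp _ = (hmΨ v).toLp _ + (hmΨ w).toLp _ := by
          rw [← MemLp.toLp_add]
          refine MemLp.toLp_congr _ _ (Eventually.of_forall fun t => ?_)
          simp only [map_add, Pi.add_apply]
        rw [e, Prod.fst_add, mulVec_add, map_add, ← Prod.mk_add_mk, WithLp.toLp_add]
      map_smul' := fun r v => by
        have e : (hmΨ (r • v)).toLp _ = r • (hmΨ v).toLp _ := by
          rw [← MemLp.toLp_const_smul]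
          refine MemLp.toLp_congr _ _ (Eventually.of_forall fun t => ?_)
          simp only [map_smul, Pi.smul_apply]
        rw [e, Prod.smul_fst, mulVec_smul, map_smul, ← Prod.smul_mk, WithLp.toLp_smul,
          RingHom.id_apply] }
  let L : ((Fin n → ℝ) × C(ℝ, Fin n → ℝ)) →ₗ[ℝ] ℝ :=
    { toFun := fun v => ℓ ⬝ᵥ (F *ᵥ testState n v τ)
      map_add' := fun v w => by rw [map_add, Pi.add_apply, mulVec_add, dotProduct_add]
      map_smul' := fun r v => by
        rw [map_smul, Pi.smul_apply, mulVec_smul, dotProduct_smul, RingHom.id_apply] }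
  have hTn : ∀ v, ‖T v‖ ^ 2 = rho (F *ᵥ testState n v 0) (fun t => (testInput F A H v t).1)
      (fun t => (testInput F A H v t).2) τ Q₀ Q R := by
    intro v
    refine (norm_sq_toLp_prod hτ.le _ (hmΨ v)).trans ?_
    rw [testState_zero, hΨ₀, rho]
    congr 1
    exact intervalIntegral.integral_congr fun t _ => hΨ _ _
  have hbound : ∀ v, ‖T v‖ ≤ 1 → (L v) ^ 2 ≤ c := by
    intro v hv
    have hadm : IsAdmissible F A H Q₀ Q R (Set.Icc 0 τ) (testState n v)
        (fun t => (testInput F A H v t).1) 0 (fun t => (testInput F A H v t).2) := by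
      -- The bound is required at every `t ≤ τ`; it follows from the one at `τ` because the
      -- integrand is nonnegative.
      refine ⟨isSolution_testState v τ, fun t ht => ?_⟩
      have h2 : ‖T v‖ ^ 2 ≤ 1 := pow_le_one₀ (norm_nonneg _) hv
      rw [hTn] at h2
      refine le_trans ?_ h2
      unfold rho
      refine add_le_add le_rfl ?_
      have hcont : Continuous fun t => ‖Ψ (testInput F A H v t)‖ ^ 2 :=
        (Ψ.continuous.comp (continuous_testInput v)).norm.pow 2
      have hrw : ∀ t, (testInput F A H v t).1 ⬝ᵥ (Q *ᵥ (testInput F A H v t).1)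
          + (testInput F A H v t).2 ⬝ᵥ (R *ᵥ (testInput F A H v t).2)
          = ‖Ψ (testInput F A H v t)‖ ^ 2 := fun t => (hΨ _ _).symm
      simp only [hrw]
      exact intervalIntegral.integral_mono_interval le_rfl ht.1 ht.2
        (Eventually.of_forall fun _ => by positivity) (hcont.intervalIntegrable _ _)
    unfold worstCaseError at hc
    simp only [iSup_le_iff] at hc
    have h3 := hc _ _ _ _ hadm
    rw [EReal.coe_le_coe_iff] at h3
    have h4 : estimate U 0 τ = 0 := by simp [estimate]
    rwa [h4, sub_zero] at h3
  obtain ⟨k, hkc, hk⟩ := exists_inner_representation T L c hbound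
  set a : Fin m → ℝ := Φ₀.symm k.fst with ha
  set κ := k.snd with hκ
  have hκm : MemLp κ 2 (volume.restrict (Set.Icc 0 τ)) := Lp.memLp κ
  have hkn : ‖k‖ ^ 2 = ‖k.fst‖ ^ 2 + ∫ t in (0 : ℝ)..τ, ‖κ t‖ ^ 2 := by
    have := norm_sq_toLp_prod hτ.le k.fst hκm
    rwa [Lp.toLp_coeFn] at this
  set z : ℝ → Fin m → ℝ := fun t => (Φ.symm (κ t)).1 with hz
  set v : ℝ → Fin p → ℝ := fun t => (Φ.symm (κ t)).2 with hv
  have hzm : MemLp z 2 (volume.restrict (Set.Icc 0 τ)) :=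
    ((ContinuousLinearMap.fst ℝ _ _).comp Φ.symm.toContinuousLinearMap).comp_memLp' hκm
  have hvm : MemLp v 2 (volume.restrict (Set.Icc 0 τ)) :=
    ((ContinuousLinearMap.snd ℝ _ _).comp Φ.symm.toContinuousLinearMap).comp_memLp' hκm
  have hκΦ : ∀ t, κ t = Φ (z t, v t) := fun t => by simp [hz, hv]
  set r : ℝ → Fin n → ℝ := fun t => Aᵀ *ᵥ z t + Hᵀ *ᵥ v t with hr
  have hrm : MemLp r 2 (volume.restrict (Set.Icc 0 τ)) :=
    (MemLp.mulVec Aᵀ hzm).add (MemLp.mulVec Hᵀ hvm)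
  -- The term `x ⬝ r` of the Riesz identity is integrated by parts with the primitive `P` of `r`.
  -- Only `x(0)` and the free function `ψ = x'` remain, and each can be varied independently.
  have hri : ∀ s ∈ Set.Icc 0 τ, ∀ t ∈ Set.Icc 0 τ, IntervalIntegrable r volume s t :=
    fun s hs t ht => MemLp.intervalIntegrable_of_Icc hrm hs ht
  set P : ℝ → Fin n → ℝ := fun t => ∫ s in (0 : ℝ)..t, r s with hP
  have hPc : ContinuousOn P (Set.Icc 0 τ) := by
    have := intervalIntegral.continuousOn_primitive_interval' (hri 0 h0 τ h1) Set.left_mem_uIcc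
    rwa [Set.uIcc_of_le hτ.le] at this
  have hPm : MemLp P 2 (volume.restrict (Set.Icc 0 τ)) := by
    obtain ⟨C, hC⟩ := isCompact_Icc.exists_bound_of_continuousOn hPc
    exact MemLp.of_bound (hPc.aestronglyMeasurable measurableSet_Icc) C
      ((ae_restrict_iff' measurableSet_Icc).2 (Eventually.of_forall hC))
  set ζ : Fin n → ℝ := Fᵀ *ᵥ ℓ + P τ with hζ
  have key : ∀ w : (Fin n → ℝ) × C(ℝ, Fin n → ℝ),
      ζ ⬝ᵥ (w.1 + ∫ t in (0 : ℝ)..τ, w.2 t)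
        = (Fᵀ *ᵥ a) ⬝ᵥ w.1 + ∫ t in (0 : ℝ)..τ, (Fᵀ *ᵥ z t + P t) ⬝ᵥ w.2 t := by
    intro w
    have hxm : MemLp (testState n w) 2 (volume.restrict (Set.Icc 0 τ)) :=
      Continuous.memLp_Icc (continuous_testState w) 0 τ
    have hψm : MemLp w.2 2 (volume.restrict (Set.Icc 0 τ)) :=
      Continuous.memLp_Icc w.2.continuous 0 τ
    have e1 := hk w
    have e2 := inner_toLp_prod hτ.le k.fst (Ψ₀ (F *ᵥ w.1)) hκm (hmΨ w)
    rw [Lp.toLp_coeFn] at e2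
    have e3 : L w = inner ℝ k.fst (Ψ₀ (F *ᵥ w.1))
        + ∫ t in (0 : ℝ)..τ, inner ℝ (κ t) (Ψ (testInput F A H w t)) := e1.trans e2
    have e4 : k.fst = Φ₀ a := by simp [ha]
    rw [e4, hΦΨ₀] at e3
    have e5 : ∀ t, inner ℝ (κ t) (Ψ (testInput F A H w t))
        = ((Fᵀ *ᵥ z t + P t) ⬝ᵥ w.2 t)
          - (w.2 t ⬝ᵥ P t + testState n w t ⬝ᵥ r t) := by
      intro t
      rw [hκΦ, testInput_apply, hΦΨ, hr]
      simp only [dotProduct_sub, dotProduct_neg, add_dotProduct, dotProduct_add]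
      rw [transpose_mulVec_dotProduct F, dotProduct_comm (testState n w t) (Aᵀ *ᵥ z t),
        dotProduct_comm (testState n w t) (Hᵀ *ᵥ v t), transpose_mulVec_dotProduct,
        transpose_mulVec_dotProduct, dotProduct_comm (w.2 t) (P t)]
      ring
    simp only [e5] at e3
    rw [intervalIntegral.integral_sub
      (MemLp.intervalIntegrable_dotProduct hτ.le (f := fun t => Fᵀ *ᵥ z t + P t)
        ((MemLp.mulVec Fᵀ hzm).add hPm) hψm)
      ((MemLp.intervalIntegrable_dotProduct hτ.le hψm hPm).add
        (MemLp.intervalIntegrable_dotProduct hτ.le hxm hrm)),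
      integral_dotProduct_primitive (a := w.2) (b := r) (α := testState n w) (β := P) hτ.le
        (w.2.continuous.intervalIntegrable _ _) (hri 0 h0 τ h1)
        (fun t _ => by rw [testState_zero, testState_apply])
        (fun t _ => by simp [hP])] at e3
    have e6 : P 0 = 0 := by simp [hP]
    have e7 : L w = (Fᵀ *ᵥ ℓ) ⬝ᵥ testState n w τ := by
      rw [transpose_mulVec_dotProduct]; rfl
    rw [e6, dotProduct_zero, sub_zero, e7] at e3
    rw [← testState_apply, hζ, add_dotProduct, e3, transpose_mulVec_dotProduct,
      dotProduct_comm (P τ)]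
    ring
  have hζa : ζ = Fᵀ *ᵥ a := by
    -- Constant test states (`ψ = 0`) give the boundary relation.
    refine dotProduct_eq _ _ fun e => ?_
    have := key (e, 0)
    simpa using this
  have hae : ∀ᵐ t ∂(volume.restrict (Set.Icc 0 τ)), Fᵀ *ᵥ z t + P t - ζ = 0 := by
    have hm1 : MemLp (fun t => Fᵀ *ᵥ z t + P t) 2 (volume.restrict (Set.Icc 0 τ)) :=
      (MemLp.mulVec Fᵀ hzm).add hPm
    have hm2 : MemLp (fun _ : ℝ => ζ) 2 (volume.restrict (Set.Icc 0 τ)) := memLp_const ζ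
    refine ae_eq_zero_of_integral_dotProduct_continuous hτ.le (hm1.sub hm2) fun ψ => ?_
    have hψm : MemLp ψ 2 (volume.restrict (Set.Icc 0 τ)) := Continuous.memLp_Icc ψ.continuous 0 τ
    -- Test states starting at zero, with arbitrary derivative `ψ`, give the integrated dual
    -- equation `Fᵀz + P = ζ` almost everywhere.
    have e1 := key (0, ψ)
    simp only [zero_add, dotProduct_zero] at e1
    simp only [sub_dotProduct]
    rw [intervalIntegral.integral_sub (MemLp.intervalIntegrable_dotProduct hτ.le hm1 hψm)
      (MemLp.intervalIntegrable_dotProduct hτ.le hm2 hψm), ← e1, sub_eq_zero]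
    have : Continuous fun x : Fin n → ℝ => ζ ⬝ᵥ x := by fun_prop
    let g : (Fin n → ℝ) →L[ℝ] ℝ := ⟨dotProductBilin ℝ ℝ ζ, this⟩
    exact (g.intervalIntegral_comp_comm (ψ.continuous.intervalIntegrable 0 τ)).symm
  -- Time reversal, with `v` negated, turns `r = Aᵀz + Hᵀv` into the dual drift; the state is `ζ -
  -- P(τ - s)`, equal to `Fᵀℓ` at `s = 0` and to `ζ = Fᵀa` at `s = τ`.
  set w : ℝ → CostSpace m p := fun s => Φ (z (τ - s), -v (τ - s)) with hw
  have hwm : MemLp w 2 (volume.restrict (Set.Icc 0 τ)) :=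
    (Φ.toContinuousLinearMap.comp_memLp' (MemLp.prodMk hzm hvm.neg)).comp_measurePreserving
      (measurePreserving_reflect τ)
  have hstate : ∀ s, s ∈ Set.Icc 0 τ →
      trajState ((dualDrift A H).comp Φ.symm.toContinuousLinearMap) (Fᵀ *ᵥ ℓ) w s
        = ζ - P (τ - s) := by
    intro s hs
    have hs' : τ - s ∈ Set.Icc 0 τ := ⟨by linarith [hs.2], by linarith [hs.1]⟩
    have e1 : ∀ t, ((dualDrift A H).comp Φ.symm.toContinuousLinearMap) (w t) = r (τ - t) := by
      intro t
      simp [hw, hr, mulVec_neg]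
    rw [trajState]
    simp only [e1]
    rw [intervalIntegral.integral_comp_sub_left (fun t => r t) τ, sub_zero, hζ, hP]
    simp only
    rw [← intervalIntegral.integral_add_adjacent_intervals (hri 0 h0 _ hs') (hri _ hs' τ h1)]
    abel
  have htraj : IsTrajectory ((dualOutput p F).comp Φ.symm.toContinuousLinearMap)
      ((dualDrift A H).comp Φ.symm.toContinuousLinearMap) (Fᵀ *ᵥ ℓ) (Set.Icc 0 τ) w := by
    unfold IsTrajectory
    filter_upwards [(measurePreserving_reflect τ).quasiMeasurePreserving.ae hae,
      ae_restrict_mem measurableSet_Icc] with s e1 hs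
    rw [hstate s hs, eq_sub_iff_add_eq, ← sub_eq_zero, ← e1]
    simp [hw]
  obtain ⟨q, hq, hqw, hqs⟩ := exists_isDualSolution Φ measurableSet_Icc Set.ordConnected_Icc
    (fun t ht => ht.1) h0 h1 hτ
    (fun a b hab => hwm.mono_measure (Measure.restrict_mono hab le_rfl)) htraj
  refine ⟨q, _, hq, le_trans ?_ hkc⟩
  have hterm : q τ ⬝ᵥ (Qbar F Q₀ *ᵥ q τ) ≤ ‖k.fst‖ ^ 2 := by
    have e4 : k.fst = Φ₀ a := by simp [ha]
    rw [e4, hΦ₀]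
    refine terminalVec_le F hQ₀ ?_
    rw [hqs τ h1, hstate τ h1, ← hζa]
    simp [hP]
  rw [dualCost_eq hΦ, hkn]
  refine add_le_add hterm (le_of_eq ?_)
  have e1 : ∫ t in (0 : ℝ)..τ, ‖Φ (q t, (Φ.symm (w t)).2)‖ ^ 2
      = ∫ t in (0 : ℝ)..τ, ‖w t‖ ^ 2 := by
    rw [intervalIntegral.integral_of_le hτ.le, intervalIntegral.integral_of_le hτ.le,
      ← integral_Icc_eq_integral_Ioc, ← integral_Icc_eq_integral_Ioc]
    refine integral_congr_ae ?_
    filter_upwards [hqw] with t ht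
    rw [ht]
  have e2 := intervalIntegral.integral_comp_sub_left (a := 0) (b := τ) (fun s => ‖κ s‖ ^ 2) τ
  rw [sub_self, sub_zero] at e2
  rw [e1, ← e2]
  refine intervalIntegral.integral_congr fun s _ => ?_
  simp only [hw, hκΦ, hΦ, neg_dotProduct, mulVec_neg, dotProduct_neg, neg_neg]

end Duality

/-! ### The infinite horizon problem -/

section InfiniteHorizon

variable {m n p : ℕ} {F A : Matrix (Fin m) (Fin n) ℝ} {H : Matrix (Fin p) (Fin n) ℝ}
  {Q₀ Q : Matrix (Fin m) (Fin m) ℝ} {R : Matrix (Fin p) (Fin p) ℝ} {ℓ : Fin m → ℝ}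

theorem dualValue_le {τ : ℝ} {q : ℝ → Fin m → ℝ} {u : ℝ → Fin p → ℝ}
    (h : IsDualSolution F A H ℓ (Set.Icc 0 τ) q u) :
    dualValue F A H Q₀ Q R ℓ τ ≤ ((dualCost F Q₀ Q R q u τ : ℝ) : EReal) :=
  iInf_le_of_le q (iInf_le_of_le u (iInf_le_of_le h le_rfl))

theorem dualValue_le_worstCaseError (hQ₀ : Q₀.PosDef) (hQ : Q.PosDef) (hR : R.PosDef) {τ : ℝ}
    (hτ : 0 < τ) (U : ℝ → Fin p → ℝ) :
    dualValue F A H Q₀ Q R ℓ τ ≤ worstCaseError F A H Q₀ Q R ℓ U τ := by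
  -- It suffices to consider real `c` above the worst-case error; an infinite error leaves nothing
  -- to check.
  refine EReal.le_of_forall_lt_iff_le.1 fun c hc => ?_
  obtain ⟨q, u, hd, hcost⟩ := exists_dualCost_le hQ₀ hQ hR hτ hc.le
  exact (dualValue_le hd).trans (EReal.coe_le_coe_iff.2 hcost)

theorem limsup_dualValue_le_asymptoticError (hQ₀ : Q₀.PosDef) (hQ : Q.PosDef) (hR : R.PosDef)
    (U : ℝ → ℝ → Fin p → ℝ) :
    limsup (fun τ : ℝ => dualValue F A H Q₀ Q R ℓ τ) atTop
      ≤ asymptoticError F A H Q₀ Q R ℓ U := by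
  refine limsup_le_limsup ?_
  filter_upwards [eventually_gt_atTop 0] with τ hτ
    using dualValue_le_worstCaseError hQ₀ hQ hR hτ (U τ)

theorem integral_norm_sq_le_dualCost (hQ₀ : Q₀.PosDef)
    {Φ : ((Fin m → ℝ) × (Fin p → ℝ)) ≃L[ℝ] CostSpace m p}
    (hΦ : ∀ q u, ‖Φ (q, u)‖ ^ 2 = q ⬝ᵥ (Q⁻¹ *ᵥ q) + u ⬝ᵥ (R⁻¹ *ᵥ u)) {s τ : ℝ} (hs : 0 ≤ s)
    (hsτ : s ≤ τ) {q : ℝ → Fin m → ℝ} {u : ℝ → Fin p → ℝ}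
    (h : IsDualSolution F A H ℓ (Set.Icc 0 τ) q u) :
    ∫ t in (0 : ℝ)..s, ‖Φ (q t, u t)‖ ^ 2 ≤ dualCost F Q₀ Q R q u τ := by
  rw [dualCost_eq hΦ]
  have h1 := dotProduct_Qbar_mulVec_nonneg F hQ₀ (q τ)
  have h2 := intervalIntegral.integral_mono_interval le_rfl hs hsτ
    (Eventually.of_forall fun t => by positivity)
    (MemLp.intervalIntegrable_norm_sq (h.memLp Φ le_rfl) (a := 0) (b := τ)
      ⟨le_rfl, hs.trans hsτ⟩ ⟨hs.trans hsτ, le_rfl⟩)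
  linarith

variable (F A H ℓ) in
/-- The running cost of dual solutions can be kept bounded on all intervals `[0, N]`. -/
def HasBoundedRunningCost (Φ : ((Fin m → ℝ) × (Fin p → ℝ)) ≃L[ℝ] CostSpace m p) : Prop :=
  ∃ c : ℝ, ∀ N : ℕ, ∃ w : ℝ → CostSpace m p, MemLp w 2 (volume.restrict (Set.Icc 0 (N : ℝ))) ∧
    IsTrajectory ((dualOutput p F).comp Φ.symm.toContinuousLinearMap)
      ((dualDrift A H).comp Φ.symm.toContinuousLinearMap) (Fᵀ *ᵥ ℓ) (Set.Icc 0 (N : ℝ)) w ∧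
    ∫ t in (0 : ℝ)..N, ‖w t‖ ^ 2 ≤ c

theorem IsDetectable.hasBoundedRunningCost (h : IsDetectable F A H ℓ)
    (Φ : ((Fin m → ℝ) × (Fin p → ℝ)) ≃L[ℝ] CostSpace m p) :
    HasBoundedRunningCost F A H ℓ Φ := by
  obtain ⟨q, u, hd, hlim⟩ := h
  refine exists_bounded_cost (w₀ := fun t => Φ (q t, u t))
    ⟨fun T => hd.memLp Φ Set.Icc_subset_Ici_self, hd.isTrajectory Φ measurableSet_Ici, ?_⟩
  refine hlim.congr' ?_
  filter_upwards [eventually_ge_atTop 0] with t ht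
  exact (hd.trajState_eq Φ ht).symm

/-- For each `N` a nearly optimal dual solution on some longer horizon is restricted to `[0, N]`;
dropping the terminal cost and the later running cost only lowers the total. -/
theorem hasBoundedRunningCost_of_limsup_lt_top (hQ₀ : Q₀.PosDef)
    {Φ : ((Fin m → ℝ) × (Fin p → ℝ)) ≃L[ℝ] CostSpace m p}
    (hΦ : ∀ q u, ‖Φ (q, u)‖ ^ 2 = q ⬝ᵥ (Q⁻¹ *ᵥ q) + u ⬝ᵥ (R⁻¹ *ᵥ u))
    (h : limsup (fun τ : ℝ => dualValue F A H Q₀ Q R ℓ τ) atTop < ⊤) :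
    HasBoundedRunningCost F A H ℓ Φ := by
  obtain ⟨c, hc, -⟩ := EReal.lt_iff_exists_real_btwn.1 h
  have hev := eventually_lt_of_limsup_lt hc
  refine ⟨c, fun N => ?_⟩
  obtain ⟨τ, hτ, hNτ⟩ := (hev.and (eventually_ge_atTop (N : ℝ))).exists
  simp only [dualValue, iInf_lt_iff] at hτ
  obtain ⟨q, u, hd, hlt⟩ := hτ
  have hd' := hd.mono (Set.Icc_subset_Icc le_rfl hNτ)
  exact ⟨fun t => Φ (q t, u t), hd'.memLp Φ le_rfl, hd'.isTrajectory Φ measurableSet_Icc,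
    (integral_norm_sq_le_dualCost hQ₀ hΦ (Nat.cast_nonneg N) hNτ hd).trans
      (EReal.coe_lt_coe_iff.1 hlt).le⟩

/-- The limit trajectory on the half-line has vanishing terminal cost, so its dual costs converge to
its total running cost `v`. Conversely, any `b < v` is exceeded by every running cost on some `[0,
N]`, hence by every dual cost on longer horizons. -/
theorem exists_isDualOptimal (hQ₀ : Q₀.PosDef)
    {Φ : ((Fin m → ℝ) × (Fin p → ℝ)) ≃L[ℝ] CostSpace m p}
    (hΦ : ∀ q u, ‖Φ (q, u)‖ ^ 2 = q ⬝ᵥ (Q⁻¹ *ᵥ q) + u ⬝ᵥ (R⁻¹ *ᵥ u))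
    (h : HasBoundedRunningCost F A H ℓ Φ) :
    ∃ (q : ℝ → Fin m → ℝ) (u : ℝ → Fin p → ℝ), IsDualOptimal F A H Q₀ Q R ℓ q u ∧
      Tendsto (fun t => Fᵀ *ᵥ q t) atTop (𝓝 0) := by
  obtain ⟨c, hc⟩ := h
  obtain ⟨w, hm, ht, hopt⟩ := exists_optimal_trajectory c hc
  obtain ⟨q, hd, hqw, hqs⟩ := exists_isDualSolution Φ measurableSet_Ici Set.ordConnected_Ici le_rfl
    Set.self_mem_Ici (Set.mem_Ici.2 zero_le_one) one_pos
    (fun a b hab => hm.mono_measure (Measure.restrict_mono hab le_rfl)) ht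
  set u : ℝ → Fin p → ℝ := fun t => (Φ.symm (w t)).2 with hu
  set v : ℝ := ∫ t in Set.Ioi (0 : ℝ), ‖w t‖ ^ 2 with hv
  have hFq : Tendsto (fun t => Fᵀ *ᵥ q t) atTop (𝓝 0) := by
    refine (tendsto_trajState_of_memLp hm ht).congr' ?_
    filter_upwards [eventually_ge_atTop 0] with t h0
    exact (hqs t h0).symm
  have hJ : Tendsto (fun τ => dualCost F Q₀ Q R q u τ) atTop (𝓝 v) := by
    have h1 := tendsto_dotProduct_Qbar_mulVec F (Q₀ := Q₀) hFq
    have hInt : IntegrableOn (fun t => ‖w t‖ ^ 2) (Set.Ioi 0) :=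
      (hm.integrable_norm_pow (p := 2) (by norm_num)).mono_measure
        (Measure.restrict_mono Set.Ioi_subset_Ici_self le_rfl)
    have h2 := intervalIntegral_tendsto_integral_Ioi 0 hInt tendsto_id
    have h3 := h1.add h2
    rw [zero_add] at h3
    refine h3.congr' ?_
    filter_upwards [eventually_ge_atTop 0] with τ hτ
    rw [dualCost_eq hΦ]
    congr 1
    refine intervalIntegral.integral_congr_ae ?_
    rw [id, Set.uIoc_of_le hτ]
    filter_upwards [(ae_restrict_iff' measurableSet_Ici).1 hqw] with t h4 h5
    rw [h4 h5.1.le]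
  have hlim : limsup (fun τ : ℝ => ((dualCost F Q₀ Q R q u τ : ℝ) : EReal)) atTop = (v : EReal) :=
    ((continuous_coe_real_ereal.tendsto v).comp hJ).limsup_eq
  have hle : limsup (fun τ : ℝ => dualValue F A H Q₀ Q R ℓ τ) atTop ≤ (v : EReal) := by
    rw [← hlim]
    exact limsup_le_limsup (Eventually.of_forall fun τ => dualValue_le
      (hd.mono Set.Icc_subset_Ici_self))
  have hge : (v : EReal) ≤ limsup (fun τ : ℝ => dualValue F A H Q₀ Q R ℓ τ) atTop := by
    refine EReal.ge_of_forall_gt_iff_ge.1 fun b hb => ?_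
    obtain ⟨N, hN⟩ := hopt b (EReal.coe_lt_coe_iff.1 hb)
    refine le_limsup_of_frequently_le (Eventually.frequently ?_)
    filter_upwards [eventually_ge_atTop (N : ℝ)] with τ hτ
    refine le_iInf fun q' => le_iInf fun u' => le_iInf fun hd' => EReal.coe_le_coe_iff.2 ?_
    have hd'' := hd'.mono (Set.Icc_subset_Icc le_rfl hτ)
    exact (hN _ (hd''.memLp Φ le_rfl) (hd''.isTrajectory Φ measurableSet_Icc)).le.trans
      (integral_norm_sq_le_dualCost hQ₀ hΦ (Nat.cast_nonneg N) hτ hd')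
  have heq := le_antisymm hle hge
  exact ⟨q, u, ⟨hd, by rw [hlim, heq], by rw [heq]; exact EReal.coe_lt_top v⟩, hFq⟩

/-- An optimal solution of the dual problem generates an infinite-horizon minimax observer. -/
theorem IsDualOptimal.isMinimaxObserver (hQ₀ : Q₀.PosDef) (hQ : Q.PosDef) (hR : R.PosDef)
    {q : ℝ → Fin m → ℝ} {u : ℝ → Fin p → ℝ} (h : IsDualOptimal F A H Q₀ Q R ℓ q u) :
    IsMinimaxObserver F A H Q₀ Q R ℓ (fun t s => u (t - s)) ∧
      asymptoticError F A H Q₀ Q R ℓ (fun t s => u (t - s))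
        = limsup (fun τ : ℝ => dualValue F A H Q₀ Q R ℓ τ) atTop := by
  have hle : asymptoticError F A H Q₀ Q R ℓ (fun t s => u (t - s))
      ≤ limsup (fun τ : ℝ => dualValue F A H Q₀ Q R ℓ τ) atTop := by
    rw [← h.limsup_eq]
    refine limsup_le_limsup ?_
    filter_upwards [eventually_ge_atTop 0] with τ hτ
    exact worstCaseError_le_dualCost hQ₀ hQ hR hτ (h.solution.mono Set.Icc_subset_Ici_self)
  have hmem : (fun t s => u (t - s)) ∈ observerClass p := fun τ _ =>
    (h.solution.memLp_u 0 τ Set.Icc_subset_Ici_self).comp_measurePreserving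
      (measurePreserving_reflect τ)
  refine ⟨⟨hmem, le_antisymm (le_iInf₂ fun V _ => ?_) (iInf₂_le _ hmem),
    hle.trans_lt h.lt_top⟩, le_antisymm hle (limsup_dualValue_le_asymptoticError hQ₀ hQ hR _)⟩
  exact hle.trans (limsup_dualValue_le_asymptoticError hQ₀ hQ hR V)

end InfiniteHorizon

end MinimaxDAE

theorem theorem2 {m n p : ℕ} (F A : Matrix (Fin m) (Fin n) ℝ) (H : Matrix (Fin p) (Fin n) ℝ)
    (Q₀ Q : Matrix (Fin m) (Fin m) ℝ) (R : Matrix (Fin p) (Fin p) ℝ)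
    (hQ₀ : Q₀.PosDef) (hQ : Q.PosDef) (hR : R.PosDef) (ℓ : Fin m → ℝ) :
    (IsDetectable F A H ℓ ↔ ∃ U, IsMinimaxObserver F A H Q₀ Q R ℓ U) ∧
    (IsDetectable F A H ℓ ↔
      ∃ (U : ℝ → ℝ → Fin p → ℝ) (q : ℝ → Fin m → ℝ) (u : ℝ → Fin p → ℝ),
        IsMinimaxObserver F A H Q₀ Q R ℓ U ∧
        IsDualOptimal F A H Q₀ Q R ℓ q u ∧
        (∀ t : ℝ, 0 < t → ∀ s ∈ Set.Icc 0 t, U t s = u (t - s)) ∧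
        asymptoticError F A H Q₀ Q R ℓ U
          = limsup (fun τ : ℝ => dualValue F A H Q₀ Q R ℓ τ) atTop) := by
  obtain ⟨Φ, -, hΦ, -, -⟩ := exists_weight_equiv_prod hQ hR
  have hopt : IsDetectable F A H ℓ → ∃ (q : ℝ → Fin m → ℝ) (u : ℝ → Fin p → ℝ),
      IsDualOptimal F A H Q₀ Q R ℓ q u := fun h =>
    let ⟨q, u, hqu, _⟩ := exists_isDualOptimal hQ₀ hΦ (h.hasBoundedRunningCost Φ)
    ⟨q, u, hqu⟩
  -- Only finiteness of the error of `U` is used: it bounds the limsup of the dual values, and the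
  -- resulting optimal dual solution has `Fᵀq → 0`.
  have hdet : ∀ U, IsMinimaxObserver F A H Q₀ Q R ℓ U → IsDetectable F A H ℓ := fun U hU =>
    let ⟨q, u, hqu, hlim⟩ := exists_isDualOptimal hQ₀ hΦ
      (hasBoundedRunningCost_of_limsup_lt_top hQ₀ hΦ
        ((limsup_dualValue_le_asymptoticError hQ₀ hQ hR U).trans_lt hU.lt_top))
    ⟨q, u, hqu.solution, hlim⟩
  refine ⟨⟨fun h => ?_, fun ⟨U, hU⟩ => hdet U hU⟩, fun h => ?_, fun ⟨U, _, _, hU, _⟩ => hdet U hU⟩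
  · obtain ⟨q, u, hqu⟩ := hopt h
    exact ⟨_, (hqu.isMinimaxObserver hQ₀ hQ hR).1⟩
  · obtain ⟨q, u, hqu⟩ := hopt h
    obtain ⟨hU, hσ⟩ := hqu.isMinimaxObserver hQ₀ hQ hR
    exact ⟨_, q, u, hU, hqu, fun _ _ _ _ => rfl, hσ⟩
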